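/- **Theorem.** Symmetric medial linearly distributive categories (0-cells), strong symmetric medial linear functors (1-cells) and strong medial linear transformations (2-cells), with the identities and compositions described below, form a (strict) 2-category $\mathbf{SMLDC}$. In particular, identities and composites of strong symmetric medial linear functors are again strong symmetric medial linear functors (including the coherences (SMLF.4)–(SMLF.6) below), and identities, vertical composites and horizontal composites of strong medial linear transformations are again such. Conventions. Composition is written $;$ in diagrammatic order, and all families of maps are natural in all their indices. A monoidal functor $(F,m_I,m)$ has coherent structure maps $m_I\colon I\to F(I)$, $m_{A,B}\colon F(A)\oslash F(B)\to F(A\oslash B)$; a comonoidal functor has coherent structure maps in the opposite direction; (co)monoidal transformations are natural transformations compatible with the structure maps. **0-cells.** A *symmetric medial linearly distributive category* (SMLDC) is a category with two symmetric monoidal structures $(\otimes,\top)$ and $(\oplus,\bot)$, with associators $\alpha_\otimes\colon (A\otimes B)\otimes C\to A\otimes(B\otimes C)$, $\alpha_\oplus\colon A\oplus(B\oplus C)\to(A\oplus B)\oplus C$, unitors $u^L_\otimes\colon A\to\top\otimes A$, $u^R_\otimes\colon A\to A\otimes\top$, $u^L_\oplus\colon\bot\oplus A\to A$, $u^R_\oplus\colon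 A\oplus\bot\to A$ and braidings $\sigma_\otimes,\sigma_\oplus$, together with maps $$\delta^R\colon(A\oplus B)\otimes C\to A\oplus(B\otimes C),\quad \delta^L\colon A\otimes(B\oplus C)\to(A\otimes B)\oplus C,$$ $$\Delta_\bot\colon\bot\to\bot\otimes\bot,\quad \nabla_\top\colon\top\oplus\top\to\top,\quad m\colon\bot\to\top,\quad \mu\colon(A\otimes B)\oplus(C\otimes D)\to(A\oplus C)\otimes(B\oplus D)$$ such that: 1. (linearly distributive) - $u^L_\otimes;\delta^L=u^L_\otimes\oplus1$, $u^R_\otimes;\delta^R=1\oplus u^R_\otimes$, $\delta^R;u^L_\oplus=u^L_\oplus\otimes1$, $\delta^L;u^R_\oplus=1\otimes u^R_\oplus$; - $\delta^L;(\alpha_\otimes\oplus1)=\alpha_\otimes;(1\otimes\delta^L);\delta^L$, $\ \alpha_\otimes;\delta^R=(\delta^R\otimes1);\delta^R;(1\oplus\alpha_\otimes)$, $\ \delta^L;\alpha_\oplus=(1\otimes\alpha_\oplus);\delta^L;(\delta^L\oplus1)$, $\ (\alpha_\oplus\otimes1);\delta^R=\delta^R;(1\oplus\delta^R);\alpha_\oplus$;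 - $\delta^L;(\delta^R\oplus1)=\delta^R;(1\oplus\delta^L);\alpha_\oplus$, $\ (\delta^L\otimes1);\delta^R=\alpha_\otimes;(1\otimes\delta^R);\delta^L$; - $\delta^R_{A,B,C}=\sigma_\otimes;(1\otimes\sigma_\oplus);\delta^L_{C,B,A};(\sigma_\otimes\oplus1);\sigma_\oplus$. 2. (mix) the two maps $A\otimes B\to A\oplus B$ obtained from $m$ agree: $(1\otimes (u^L_\oplus)^{-1});(1\otimes(m\oplus1));\delta^L;((u^R_\otimes)^{-1}\oplus1)=((u^R_\oplus)^{-1}\otimes1);((1\oplus m)\otimes1);\delta^R;(1\oplus(u^L_\otimes)^{-1})$. 3. (symmetric duoidal) $(\bot,\Delta_\bot,m)$ is a cocommutative $\otimes$-comonoid, $(\top,\nabla_\top,m)$ is a commutative $\oplus$-monoid, and - $\mu;(\mu\otimes1);\alpha_\otimes=(\alpha_\otimes\oplus\alpha_\otimes);\mu;(1\otimes\mu)$, $\ \alpha_\oplus;(\mu\oplus1);\mu=(1\oplus\mu);\mu;(\alpha_\oplus\otimes\alpha_\oplus)$; - $(\Delta_\bot\oplus1);\mu;(u^L_\oplus\otimes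 u^L_\oplus)=u^L_\oplus$, $\ (1\oplus\Delta_\bot);\mu;(u^R_\oplus\otimes u^R_\oplus)=u^R_\oplus$, $\ (u^L_\otimes\oplus u^L_\otimes);\mu;(\nabla_\top\otimes1)=u^L_\otimes$, $\ (u^R_\otimes\oplus u^R_\otimes);\mu;(1\otimes\nabla_\top)=u^R_\otimes$; - $\mu;\sigma_\otimes=(\sigma_\otimes\oplus\sigma_\otimes);\mu$, $\ \mu;(\sigma_\oplus\otimes\sigma_\oplus)=\sigma_\oplus;\mu$. 4. (medial maps and linear distributivities) - $(\mu\otimes1);\alpha_\otimes;(1\otimes\delta^R)=\delta^R;(1\oplus\alpha_\otimes);\mu$, $\ (1\otimes\mu);\alpha_\otimes^{-1};(\delta^L\otimes1)=\delta^L;(\alpha_\otimes^{-1}\oplus1);\mu$; - $(\delta^R\oplus1);\alpha_\oplus^{-1};(1\oplus\mu)=\mu;(\alpha_\oplus^{-1}\otimes1);\delta^R$, $\ (1\oplus\delta^L);\alpha_\oplus;(\mu\oplus1)=\mu;(1\otimes\alpha_\oplus);\delta^L$. **1-cells.** A *strong symmetric medial linear functor* $F\colon\mathbb X\to\mathbb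 Y$ consists of functors $F_\otimes,F_\oplus\colon\mathbb X\to\mathbb Y$ with - on $F_\otimes$, a strong symmetric monoidal structure $(m_\top,m_\otimes)$ for $\otimes$ and a symmetric monoidal structure $(m_\bot,m_\oplus)$ for $\oplus$; - on $F_\oplus$, a strong symmetric comonoidal structure $(n_\bot,n_\oplus)$ for $\oplus$ and a symmetric comonoidal structure $(n_\top,n_\otimes)$ for $\otimes$; - linear strengths $$\nu^R_\otimes\colon F_\otimes(A\oplus B)\to F_\oplus(A)\oplus F_\otimes(B),\quad \nu^L_\otimes\colon F_\otimes(A\oplus B)\to F_\otimes(A)\oplus F_\oplus(B),$$ $$\nu^R_\oplus\colon F_\otimes(A)\otimes F_\oplus(B)\to F_\oplus(A\otimes B),\quad \nu^L_\oplus\colon F_\oplus(A)\otimes F_\otimes(B)\to F_\oplus(A\otimes B),$$ such that: - (SMLF.1) $(F_\otimes,m_\bot,m_\oplus,m_\top^{-1},m_\otimes^{-1})$ is a bilax duoidal functor: $\Delta_\bot;(m_\bot\otimes m_\bot);m_\otimes=m_\bot;F_\otimes(\Delta_\bot)$, $\ (m_\top\oplus m_\top);m_\oplus;F_\otimes(\nabla_\top)=\nabla_\top;m_\top$,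 $\ m;m_\top=m_\bot;F_\otimes(m)$, $\ (m_\otimes\oplus m_\otimes);m_\oplus;F_\otimes(\mu)=\mu;(m_\oplus\otimes m_\oplus);m_\otimes$. - (SMLF.2) $(F_\oplus,n_\bot^{-1},n_\oplus^{-1},n_\top,n_\otimes)$ is a bilax duoidal functor: $F_\oplus(\Delta_\bot);n_\otimes;(n_\bot\otimes n_\bot)=n_\bot;\Delta_\bot$, $\ n_\oplus;(n_\top\oplus n_\top);\nabla_\top=F_\oplus(\nabla_\top);n_\top$, $\ n_\bot;m=F_\oplus(m);n_\top$, $\ F_\oplus(\mu);n_\otimes;(n_\oplus\otimes n_\oplus)=n_\oplus;(n_\otimes\oplus n_\otimes);\mu$. - (SMLF.3) $F$ is a symmetric linear functor: - $\nu^R_\otimes;(n_\bot\oplus1);u^L_\oplus=F_\otimes(u^L_\oplus)$, $\ \nu^L_\otimes;(1\oplus n_\bot);u^R_\oplus=F_\otimes(u^R_\oplus)$, $\ u^L_\otimes;(m_\top\otimes1);\nu^R_\oplus=F_\oplus(u^L_\otimes)$, $\ u^R_\otimes;(1\otimes m_\top);\nu^L_\oplus=F_\oplus(u^R_\otimes)$;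 - $\nu^R_\otimes;(1\oplus\nu^R_\otimes);\alpha_\oplus=F_\otimes(\alpha_\oplus);\nu^R_\otimes;(n_\oplus\oplus1)$, $\ \nu^L_\otimes;(1\oplus n_\oplus);\alpha_\oplus=F_\otimes(\alpha_\oplus);\nu^L_\otimes;(\nu^L_\otimes\oplus1)$, $\ \alpha_\otimes;(1\otimes\nu^R_\oplus);\nu^R_\oplus=(m_\otimes\otimes1);\nu^R_\oplus;F_\oplus(\alpha_\otimes)$, $\ \alpha_\otimes;(1\otimes m_\otimes);\nu^L_\oplus=(\nu^L_\oplus\otimes1);\nu^L_\oplus;F_\oplus(\alpha_\otimes)$; - $m_\otimes;F_\otimes(\delta^R);\nu^R_\otimes=(\nu^R_\otimes\otimes1);\delta^R;(1\oplus m_\otimes)$, $\ m_\otimes;F_\otimes(\delta^L);\nu^L_\otimes=(1\otimes\nu^L_\otimes);\delta^L;(m_\otimes\oplus1)$, $\ \nu^R_\oplus;F_\oplus(\delta^L);n_\oplus=(1\otimes n_\oplus);\delta^L;(\nu^R_\oplus\oplus1)$, $\ \nu^L_\oplus;F_\oplus(\delta^R);n_\oplus=(n_\oplus\otimes1);\delta^R;(1\oplus\nu^L_\oplus)$;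 - $\nu^R_\otimes;(1\oplus\nu^L_\otimes);\alpha_\oplus=F_\otimes(\alpha_\oplus);\nu^L_\otimes;(\nu^R_\otimes\oplus1)$, $\ \alpha_\otimes;(1\otimes\nu^L_\oplus);\nu^R_\oplus=(\nu^R_\oplus\otimes1);\nu^L_\oplus;F_\oplus(\alpha_\otimes)$; - $m_\otimes;F_\otimes(\delta^L);\nu^R_\otimes=(1\otimes\nu^R_\otimes);\delta^L;(\nu^R_\oplus\oplus1)$, $\ m_\otimes;F_\otimes(\delta^R);\nu^L_\otimes=(\nu^L_\otimes\otimes1);\delta^R;(1\oplus\nu^L_\oplus)$, $\ \nu^R_\oplus;F_\oplus(\delta^R);n_\oplus=(\nu^R_\otimes\otimes1);\delta^R;(1\oplus\nu^R_\oplus)$, $\ \nu^L_\oplus;F_\oplus(\delta^L);n_\oplus=(1\otimes\nu^L_\otimes);\delta^L;(\nu^L_\oplus\oplus1)$; - $\nu^R_\otimes;\sigma_\oplus=F_\otimes(\sigma_\oplus);\nu^L_\otimes$, $\ \nu^R_\oplus;F_\oplus(\sigma_\otimes)=\sigma_\otimes;\nu^L_\oplus$. - (SMLF.4) $F_\oplus(\Delta_\bot)=n_\bot;\Delta_\bot;(m_\bot\otimes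 n_\bot^{-1});\nu^R_\oplus$ and $F_\otimes(\nabla_\top)=\nu^R_\otimes;(n_\top\oplus m_\top^{-1});\nabla_\top;m_\top$. - (SMLF.5) $F_\otimes(\mu);m_\otimes^{-1};(\nu^R_\otimes\otimes\nu^R_\otimes)=\nu^R_\otimes;(n_\otimes\oplus m_\otimes^{-1});\mu$ and $(\nu^R_\oplus\oplus\nu^R_\oplus);n_\oplus^{-1};F_\oplus(\mu)=\mu;(m_\oplus\otimes n_\oplus^{-1});\nu^R_\oplus$. - (SMLF.6) $m_\oplus;F_\otimes(\alpha_\oplus^{-1});\nu^R_\otimes=(\nu^R_\otimes\oplus1);\alpha_\oplus^{-1};(1\oplus m_\oplus)$ and $\nu^R_\oplus;F_\oplus(\alpha_\otimes^{-1});n_\otimes=(1\otimes n_\otimes);\alpha_\otimes^{-1};(\nu^R_\oplus\otimes1)$. The identity 1-cell is the pair of identity functors with identity structure maps. The composite of $F$ and $G$ is $(F_\otimes;G_\otimes,F_\oplus;G_\oplus)$ with the composite (co)monoidal structures and the strengths $G_\otimes(\nu^{F}_\otimes);\nu^{G}_\otimes$ and $\nu^{G}_\oplus;G_\oplus(\nu^{F}_\oplus)$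 (for both $R$ and $L$). **2-cells.** A *strong medial linear transformation* $\alpha\colon F\Rightarrow G$ is a pair of natural transformations $\alpha_\otimes\colon F_\otimes\Rightarrow G_\otimes$, $\alpha_\oplus\colon G_\oplus\Rightarrow F_\oplus$ such that $\alpha_\otimes$ is a monoidal transformation for $(m_\top,m_\otimes)$ and for $(m_\bot,m_\oplus)$, $\alpha_\oplus$ is a comonoidal transformation for $(n_\bot,n_\oplus)$ and for $(n_\top,n_\otimes)$, and $$\alpha_\otimes;\nu^{R,G}_\otimes;(\alpha_\oplus\oplus1)=\nu^{R,F}_\otimes;(1\oplus\alpha_\otimes),\qquad \alpha_\otimes;\nu^{L,G}_\otimes;(1\oplus\alpha_\oplus)=\nu^{L,F}_\otimes;(\alpha_\otimes\oplus1),$$ $$(1\otimes\alpha_\otimes);\nu^{L,G}_\oplus;\alpha_\oplus=(\alpha_\oplus\otimes1);\nu^{L,F}_\oplus,\qquad (\alpha_\otimes\otimes1);\nu^{R,G}_\oplus;\alpha_\oplus=(1\otimes\alpha_\oplus);\nu^{R,F}_\oplus.$$ Identities are pairs of identities; vertical composition is $(\alpha_\otimes;\beta_\otimes,\ \beta_\oplus;\alpha_\oplus)$,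 and horizontal composition is the usual horizontal composition of natural transformations in both components. -/

import Mathlib

open CategoryTheory

universe v u

namespace MedialLD

/-! ### Categories with two monoidal structures

The tensor structure is `(⊗ₒ, top)` and the par structure is `(⊕ₒ, bot)`; the action of the two
products on maps is written `⊗ₕ` and `⊕ₕ`. -/

/-- A category with a tensor and a par monoidal structure. -/
class TwoMonoidal (X : Type u) [Category.{v} X] where
  /-- the tensor monoidal structure -/
  ten : MonoidalCategory X
  /-- the par monoidal structure -/
  par : MonoidalCategory X

section TwoMonoidal

variable (X : Type u) [Category.{v} X] [TwoMonoidal X]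

/-- The unit of the tensor. -/
abbrev top : X := (TwoMonoidal.ten (X := X)).tensorUnit

/-- The unit of the par. -/
abbrev bot : X := (TwoMonoidal.par (X := X)).tensorUnit

variable {X}

/-- The tensor of two objects. -/
abbrev tObj (A B : X) : X := (TwoMonoidal.ten (X := X)).tensorObj A B

/-- The par of two objects. -/
abbrev pObj (A B : X) : X := (TwoMonoidal.par (X := X)).tensorObj A B

infixr:70 " ⊗ₒ " => tObj
infixr:65 " ⊕ₒ " => pObj

/-- The tensor of two maps. -/
abbrev tHom {A B C D : X} (f : A ⟶ B) (g : C ⟶ D) : A ⊗ₒ C ⟶ B ⊗ₒ D :=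
  (TwoMonoidal.ten (X := X)).tensorHom f g

/-- The par of two maps. -/
abbrev pHom {A B C D : X} (f : A ⟶ B) (g : C ⟶ D) : A ⊕ₒ C ⟶ B ⊕ₒ D :=
  (TwoMonoidal.par (X := X)).tensorHom f g

infixr:81 " ⊗ₕ " => tHom
infixr:81 " ⊕ₕ " => pHom

/-- `α_⊗ : (A ⊗ B) ⊗ C ≅ A ⊗ (B ⊗ C)`. -/
abbrev tAssoc (A B C : X) : (A ⊗ₒ B) ⊗ₒ C ≅ A ⊗ₒ (B ⊗ₒ C) :=
  (TwoMonoidal.ten (X := X)).associator A B C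

/-- `α_⊕ : A ⊕ (B ⊕ C) ≅ (A ⊕ B) ⊕ C`. -/
abbrev pAssoc (A B C : X) : A ⊕ₒ (B ⊕ₒ C) ≅ (A ⊕ₒ B) ⊕ₒ C :=
  ((TwoMonoidal.par (X := X)).associator A B C).symm

/-- `u^L_⊗ : A ≅ ⊤ ⊗ A`. -/
abbrev tL (A : X) : A ≅ top X ⊗ₒ A := ((TwoMonoidal.ten (X := X)).leftUnitor A).symm

/-- `u^R_⊗ : A ≅ A ⊗ ⊤`. -/
abbrev tR (A : X) : A ≅ A ⊗ₒ top X := ((TwoMonoidal.ten (X := X)).rightUnitor A).symm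

/-- `u^L_⊕ : ⊥ ⊕ A ≅ A`. -/
abbrev pL (A : X) : bot X ⊕ₒ A ≅ A := (TwoMonoidal.par (X := X)).leftUnitor A

/-- `u^R_⊕ : A ⊕ ⊥ ≅ A`. -/
abbrev pR (A : X) : A ⊕ₒ bot X ≅ A := (TwoMonoidal.par (X := X)).rightUnitor A

end TwoMonoidal

/-! ### Linearly distributive categories -/

/-- A linearly distributive category. -/
class LDC (X : Type u) [Category.{v} X] extends TwoMonoidal X where
  /-- the right linear distributivity -/
  δR (A B C : X) : (A ⊕ₒ B) ⊗ₒ C ⟶ A ⊕ₒ (B ⊗ₒ C)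
  /-- the left linear distributivity -/
  δL (A B C : X) : A ⊗ₒ (B ⊕ₒ C) ⟶ (A ⊗ₒ B) ⊕ₒ C
  δR_natural {A A' B B' C C' : X} (f : A ⟶ A') (g : B ⟶ B') (h : C ⟶ C') :
    ((f ⊕ₕ g) ⊗ₕ h) ≫ δR A' B' C' = δR A B C ≫ (f ⊕ₕ (g ⊗ₕ h))
  δL_natural {A A' B B' C C' : X} (f : A ⟶ A') (g : B ⟶ B') (h : C ⟶ C') :
    (f ⊗ₕ (g ⊕ₕ h)) ≫ δL A' B' C' = δL A B C ≫ ((f ⊗ₕ g) ⊕ₕ h)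
  -- units and linear distributivities
  tL_δL (A B : X) : (tL (A ⊕ₒ B)).hom ≫ δL (top X) A B = (tL A).hom ⊕ₕ 𝟙 B
  tR_δR (A B : X) : (tR (A ⊕ₒ B)).hom ≫ δR A B (top X) = 𝟙 A ⊕ₕ (tR B).hom
  δR_pL (A B : X) : δR (bot X) A B ≫ (pL (A ⊗ₒ B)).hom = (pL A).hom ⊗ₕ 𝟙 B
  δL_pR (A B : X) : δL A B (bot X) ≫ (pR (A ⊗ₒ B)).hom = 𝟙 A ⊗ₕ (pR B).hom
  -- associativities and linear distributivities
  δL_tAssoc (A B C D : X) :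
    δL (A ⊗ₒ B) C D ≫ ((tAssoc A B C).hom ⊕ₕ 𝟙 D) =
      (tAssoc A B (C ⊕ₒ D)).hom ≫ (𝟙 A ⊗ₕ δL B C D) ≫ δL A (B ⊗ₒ C) D
  δR_tAssoc (A B C D : X) :
    (tAssoc (A ⊕ₒ B) C D).hom ≫ δR A B (C ⊗ₒ D) =
      (δR A B C ⊗ₕ 𝟙 D) ≫ δR A (B ⊗ₒ C) D ≫ (𝟙 A ⊕ₕ (tAssoc B C D).hom)
  δL_pAssoc (A B C D : X) :
    δL A B (C ⊕ₒ D) ≫ (pAssoc (A ⊗ₒ B) C D).hom =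
      (𝟙 A ⊗ₕ (pAssoc B C D).hom) ≫ δL A (B ⊕ₒ C) D ≫ (δL A B C ⊕ₕ 𝟙 D)
  δR_pAssoc (A B C D : X) :
    ((pAssoc A B C).hom ⊗ₕ 𝟙 D) ≫ δR (A ⊕ₒ B) C D =
      δR A (B ⊕ₒ C) D ≫ (𝟙 A ⊕ₕ δR B C D) ≫ (pAssoc A B (C ⊗ₒ D)).hom
  -- left and right linear distributivities
  δL_δR (A B C D : X) :
    δL (A ⊕ₒ B) C D ≫ (δR A B C ⊕ₕ 𝟙 D) =
      δR A B (C ⊕ₒ D) ≫ (𝟙 A ⊕ₕ δL B C D) ≫ (pAssoc A (B ⊗ₒ C) D).hom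
  δR_δL (A B C D : X) :
    (δL A B C ⊗ₕ 𝟙 D) ≫ δR (A ⊗ₒ B) C D =
      (tAssoc A (B ⊕ₒ C) D).hom ≫ (𝟙 A ⊗ₕ δR B C D) ≫ δL A B (C ⊗ₒ D)

/-! ### Medial linearly distributive categories -/

/-- A medial linearly distributive category: a mix LDC `(X, ⊗, ⊤, ⊕, ⊥)` such that
`(X, ⊕, ⊥, ⊗, ⊤)` is a duoidal category, the two structures interacting coherently. -/
class MLDC (X : Type u) [Category.{v} X] extends LDC X where
  /-- `⊥`-contraction -/
  Δbot : bot X ⟶ bot X ⊗ₒ bot X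
  /-- `⊤`-cocontraction -/
  nablaTop : top X ⊕ₒ top X ⟶ top X
  /-- the nullary mix map -/
  mix : bot X ⟶ top X
  /-- the medial maps -/
  μ (A B C D : X) : (A ⊗ₒ B) ⊕ₒ (C ⊗ₒ D) ⟶ (A ⊕ₒ C) ⊗ₒ (B ⊕ₒ D)
  μ_natural {A A' B B' C C' D D' : X} (f : A ⟶ A') (g : B ⟶ B') (h : C ⟶ C') (k : D ⟶ D') :
    ((f ⊗ₕ g) ⊕ₕ (h ⊗ₕ k)) ≫ μ A' B' C' D' = μ A B C D ≫ ((f ⊕ₕ h) ⊗ₕ (g ⊕ₕ k))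
  -- the LDC is mix
  mix_coherence (A B : X) :
    (𝟙 A ⊗ₕ (pL B).inv) ≫ (𝟙 A ⊗ₕ (mix ⊕ₕ 𝟙 B)) ≫ δL A (top X) B ≫ ((tR A).inv ⊕ₕ 𝟙 B) =
      ((pR A).inv ⊗ₕ 𝟙 B) ≫ ((𝟙 A ⊕ₕ mix) ⊗ₕ 𝟙 B) ≫ δR A (top X) B ≫ (𝟙 A ⊕ₕ (tL B).inv)
  -- `(⊥, Δbot, mix)` is a `⊗`-comonoid
  Δbot_coassoc :
    Δbot ≫ (𝟙 (bot X) ⊗ₕ Δbot) = Δbot ≫ (Δbot ⊗ₕ 𝟙 (bot X)) ≫ (tAssoc _ _ _).hom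
  Δbot_mix_right : Δbot ≫ (𝟙 (bot X) ⊗ₕ mix) = (tR (bot X)).hom
  Δbot_mix_left : Δbot ≫ (mix ⊗ₕ 𝟙 (bot X)) = (tL (bot X)).hom
  -- `(⊤, nablaTop, mix)` is a `⊕`-monoid
  nablaTop_assoc :
    (𝟙 (top X) ⊕ₕ nablaTop) ≫ nablaTop =
      (pAssoc _ _ _).hom ≫ (nablaTop ⊕ₕ 𝟙 (top X)) ≫ nablaTop
  mix_nablaTop_right : (𝟙 (top X) ⊕ₕ mix) ≫ nablaTop = (pR (top X)).hom
  mix_nablaTop_left : (mix ⊕ₕ 𝟙 (top X)) ≫ nablaTop = (pL (top X)).hom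
  -- medial maps and associators
  μ_tAssoc (A B C D E F : X) :
    μ (A ⊗ₒ B) C (D ⊗ₒ E) F ≫ (μ A B D E ⊗ₕ 𝟙 (C ⊕ₒ F)) ≫
        (tAssoc (A ⊕ₒ D) (B ⊕ₒ E) (C ⊕ₒ F)).hom =
      ((tAssoc A B C).hom ⊕ₕ (tAssoc D E F).hom) ≫ μ A (B ⊗ₒ C) D (E ⊗ₒ F) ≫
        (𝟙 (A ⊕ₒ D) ⊗ₕ μ B C E F)
  μ_pAssoc (A B C D E F : X) :
    (pAssoc (A ⊗ₒ B) (C ⊗ₒ D) (E ⊗ₒ F)).hom ≫ (μ A B C D ⊕ₕ 𝟙 (E ⊗ₒ F)) ≫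
        μ (A ⊕ₒ C) (B ⊕ₒ D) E F =
      (𝟙 (A ⊗ₒ B) ⊕ₕ μ C D E F) ≫ μ A B (C ⊕ₒ E) (D ⊕ₒ F) ≫
        ((pAssoc A C E).hom ⊗ₕ (pAssoc B D F).hom)
  -- medial maps and unitors
  μ_pL (A B : X) :
    (Δbot ⊕ₕ 𝟙 (A ⊗ₒ B)) ≫ μ (bot X) (bot X) A B ≫ ((pL A).hom ⊗ₕ (pL B).hom) =
      (pL (A ⊗ₒ B)).hom
  μ_pR (A B : X) :
    (𝟙 (A ⊗ₒ B) ⊕ₕ Δbot) ≫ μ A B (bot X) (bot X) ≫ ((pR A).hom ⊗ₕ (pR B).hom) =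
      (pR (A ⊗ₒ B)).hom
  μ_tL (A B : X) :
    ((tL A).hom ⊕ₕ (tL B).hom) ≫ μ (top X) A (top X) B ≫ (nablaTop ⊗ₕ 𝟙 (A ⊕ₒ B)) =
      (tL (A ⊕ₒ B)).hom
  μ_tR (A B : X) :
    ((tR A).hom ⊕ₕ (tR B).hom) ≫ μ A (top X) B (top X) ≫ (𝟙 (A ⊕ₒ B) ⊗ₕ nablaTop) =
      (tR (A ⊕ₒ B)).hom
  -- medial maps and linear distributivities
  μ_δR_ten (A B C D Z : X) :
    (μ A B C D ⊗ₕ 𝟙 Z) ≫ (tAssoc (A ⊕ₒ C) (B ⊕ₒ D) Z).hom ≫ (𝟙 (A ⊕ₒ C) ⊗ₕ δR B D Z) =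
      δR (A ⊗ₒ B) (C ⊗ₒ D) Z ≫ (𝟙 (A ⊗ₒ B) ⊕ₕ (tAssoc C D Z).hom) ≫ μ A B C (D ⊗ₒ Z)
  μ_δL_ten (A B C D Z : X) :
    (𝟙 Z ⊗ₕ μ A B C D) ≫ (tAssoc Z (A ⊕ₒ C) (B ⊕ₒ D)).inv ≫ (δL Z A C ⊗ₕ 𝟙 (B ⊕ₒ D)) =
      δL Z (A ⊗ₒ B) (C ⊗ₒ D) ≫ ((tAssoc Z A B).inv ⊕ₕ 𝟙 (C ⊗ₒ D)) ≫ μ (Z ⊗ₒ A) B C D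
  μ_δR_par (A B C D Z : X) :
    (δR Z A B ⊕ₕ 𝟙 (C ⊗ₒ D)) ≫ (pAssoc Z (A ⊗ₒ B) (C ⊗ₒ D)).inv ≫ (𝟙 Z ⊕ₕ μ A B C D) =
      μ (Z ⊕ₒ A) B C D ≫ ((pAssoc Z A C).inv ⊗ₕ 𝟙 (B ⊕ₒ D)) ≫ δR Z (A ⊕ₒ C) (B ⊕ₒ D)
  μ_δL_par (A B C D Z : X) :
    (𝟙 (A ⊗ₒ B) ⊕ₕ δL C D Z) ≫ (pAssoc (A ⊗ₒ B) (C ⊗ₒ D) Z).hom ≫ (μ A B C D ⊕ₕ 𝟙 Z) =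
      μ A B C (D ⊕ₒ Z) ≫ (𝟙 (A ⊕ₒ C) ⊗ₕ (pAssoc B D Z).hom) ≫ δL (A ⊕ₒ C) (B ⊕ₒ D) Z

/-- A symmetric medial linearly distributive category. -/
class SymmetricMLDC (X : Type u) [Category.{v} X] extends MLDC X where
  /-- the symmetry of the tensor -/
  tSymm : @SymmetricCategory X _ ten
  /-- the symmetry of the par -/
  pSymm : @SymmetricCategory X _ par
  -- braidings and linear distributivities
  δR_braiding (A B C : X) :
    δR A B C =
      (tSymm.braiding (A ⊕ₒ B) C).hom ≫ (𝟙 C ⊗ₕ (pSymm.braiding A B).hom) ≫ δL C B A ≫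
        ((tSymm.braiding C B).hom ⊕ₕ 𝟙 A) ≫ (pSymm.braiding (B ⊗ₒ C) A).hom
  -- `⊥` is cocommutative, `⊤` is commutative
  Δbot_comm : Δbot ≫ (tSymm.braiding (bot X) (bot X)).hom = Δbot
  nablaTop_comm : (pSymm.braiding (top X) (top X)).hom ≫ nablaTop = nablaTop
  -- braidings and medial maps
  μ_tBraiding (A B C D : X) :
    μ A B C D ≫ (tSymm.braiding (A ⊕ₒ C) (B ⊕ₒ D)).hom =
      ((tSymm.braiding A B).hom ⊕ₕ (tSymm.braiding C D).hom) ≫ μ B A D C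
  μ_pBraiding (A B C D : X) :
    μ A B C D ≫ ((pSymm.braiding A C).hom ⊗ₕ (pSymm.braiding B D).hom) =
      (pSymm.braiding (A ⊗ₒ B) (C ⊗ₒ D)).hom ≫ μ C D A B

/-- `σ_⊗`. -/
abbrev tBraid {X : Type u} [Category.{v} X] [SymmetricMLDC X] (A B : X) : A ⊗ₒ B ≅ B ⊗ₒ A :=
  (SymmetricMLDC.tSymm (X := X)).braiding A B

/-- `σ_⊕`. -/
abbrev pBraid {X : Type u} [Category.{v} X] [SymmetricMLDC X] (A B : X) : A ⊕ₒ B ≅ B ⊕ₒ A :=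
  (SymmetricMLDC.pSymm (X := X)).braiding A B

open LDC MLDC

/-! ### Linear functors -/

section Functors

variable (X : Type u) [Category.{v} X] (Y : Type u) [Category.{v} Y]

/-- The data of a linear functor `(F_⊗, F_⊕)`: a monoidal functor for the tensors, a comonoidal
functor for the pars, and four families of linear strengths. -/
structure LinearFunctorData [LDC X] [LDC Y] where
  /-- the functor `F_⊗` -/
  Ft : X ⥤ Y
  /-- the functor `F_⊕` -/
  Fp : X ⥤ Y
  /-- the monoidal structure `(m_⊤, m_⊗)` of `F_⊗` -/
  tLax : @Functor.LaxMonoidal X _ TwoMonoidal.ten Y _ TwoMonoidal.ten Ft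
  /-- the comonoidal structure `(n_⊥, n_⊕)` of `F_⊕` -/
  pOplax : @Functor.OplaxMonoidal X _ TwoMonoidal.par Y _ TwoMonoidal.par Fp
  /-- `ν^R_⊗` -/
  νtR (A B : X) : Ft.obj (A ⊕ₒ B) ⟶ Fp.obj A ⊕ₒ Ft.obj B
  /-- `ν^L_⊗` -/
  νtL (A B : X) : Ft.obj (A ⊕ₒ B) ⟶ Ft.obj A ⊕ₒ Fp.obj B
  /-- `ν^R_⊕` -/
  νpR (A B : X) : Ft.obj A ⊗ₒ Fp.obj B ⟶ Fp.obj (A ⊗ₒ B)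
  /-- `ν^L_⊕` -/
  νpL (A B : X) : Fp.obj A ⊗ₒ Ft.obj B ⟶ Fp.obj (A ⊗ₒ B)

/-- The data of a medial linear functor: in addition, `F_⊗` is a monoidal functor for the pars and
`F_⊕` is a comonoidal functor for the tensors. -/
structure MedialFunctorData [LDC X] [LDC Y] extends LinearFunctorData X Y where
  /-- the monoidal structure `(m_⊥, m_⊕)` of `F_⊗` -/
  pLax : @Functor.LaxMonoidal X _ TwoMonoidal.par Y _ TwoMonoidal.par Ft
  /-- the comonoidal structure `(n_⊤, n_⊗)` of `F_⊕` -/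
  tOplax : @Functor.OplaxMonoidal X _ TwoMonoidal.ten Y _ TwoMonoidal.ten Fp

variable {X Y}

namespace LinearFunctorData

variable [LDC X] [LDC Y] (F : LinearFunctorData X Y)

/-- `m_⊤`. -/
abbrev mTop : top Y ⟶ F.Ft.obj (top X) := F.tLax.ε

/-- `m_⊗`. -/
abbrev mTen (A B : X) : F.Ft.obj A ⊗ₒ F.Ft.obj B ⟶ F.Ft.obj (A ⊗ₒ B) := F.tLax.μ A B

/-- `n_⊥`. -/
abbrev nBot : F.Fp.obj (bot X) ⟶ bot Y := F.pOplax.η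

/-- `n_⊕`. -/
abbrev nPar (A B : X) : F.Fp.obj (A ⊕ₒ B) ⟶ F.Fp.obj A ⊕ₒ F.Fp.obj B := F.pOplax.δ A B

/-- The data form a linear functor: the linear strengths are natural and coherent. -/
structure IsLinear : Prop where
  -- naturality of the linear strengths
  νtR_natural {A A' B B' : X} (f : A ⟶ A') (g : B ⟶ B') :
    F.Ft.map (f ⊕ₕ g) ≫ F.νtR A' B' = F.νtR A B ≫ (F.Fp.map f ⊕ₕ F.Ft.map g)
  νtL_natural {A A' B B' : X} (f : A ⟶ A') (g : B ⟶ B') :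
    F.Ft.map (f ⊕ₕ g) ≫ F.νtL A' B' = F.νtL A B ≫ (F.Ft.map f ⊕ₕ F.Fp.map g)
  νpR_natural {A A' B B' : X} (f : A ⟶ A') (g : B ⟶ B') :
    (F.Ft.map f ⊗ₕ F.Fp.map g) ≫ F.νpR A' B' = F.νpR A B ≫ F.Fp.map (f ⊗ₕ g)
  νpL_natural {A A' B B' : X} (f : A ⟶ A') (g : B ⟶ B') :
    (F.Fp.map f ⊗ₕ F.Ft.map g) ≫ F.νpL A' B' = F.νpL A B ≫ F.Fp.map (f ⊗ₕ g)
  -- units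
  νtR_unit (A : X) :
    F.νtR (bot X) A ≫ (F.nBot ⊕ₕ 𝟙 (F.Ft.obj A)) ≫ (pL (F.Ft.obj A)).hom = F.Ft.map (pL A).hom
  νtL_unit (A : X) :
    F.νtL A (bot X) ≫ (𝟙 (F.Ft.obj A) ⊕ₕ F.nBot) ≫ (pR (F.Ft.obj A)).hom = F.Ft.map (pR A).hom
  νpR_unit (A : X) :
    (tL (F.Fp.obj A)).hom ≫ (F.mTop ⊗ₕ 𝟙 (F.Fp.obj A)) ≫ F.νpR (top X) A = F.Fp.map (tL A).hom
  νpL_unit (A : X) :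
    (tR (F.Fp.obj A)).hom ≫ (𝟙 (F.Fp.obj A) ⊗ₕ F.mTop) ≫ F.νpL A (top X) = F.Fp.map (tR A).hom
  -- associativities
  νtR_assoc (A B C : X) :
    F.νtR A (B ⊕ₒ C) ≫ (𝟙 (F.Fp.obj A) ⊕ₕ F.νtR B C) ≫ (pAssoc _ _ _).hom =
      F.Ft.map (pAssoc A B C).hom ≫ F.νtR (A ⊕ₒ B) C ≫ (F.nPar A B ⊕ₕ 𝟙 (F.Ft.obj C))
  νtL_assoc (A B C : X) :
    F.νtL A (B ⊕ₒ C) ≫ (𝟙 (F.Ft.obj A) ⊕ₕ F.nPar B C) ≫ (pAssoc _ _ _).hom =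
      F.Ft.map (pAssoc A B C).hom ≫ F.νtL (A ⊕ₒ B) C ≫ (F.νtL A B ⊕ₕ 𝟙 (F.Fp.obj C))
  νpR_assoc (A B C : X) :
    (tAssoc _ _ _).hom ≫ (𝟙 (F.Ft.obj A) ⊗ₕ F.νpR B C) ≫ F.νpR A (B ⊗ₒ C) =
      (F.mTen A B ⊗ₕ 𝟙 (F.Fp.obj C)) ≫ F.νpR (A ⊗ₒ B) C ≫ F.Fp.map (tAssoc A B C).hom
  νpL_assoc (A B C : X) :
    (tAssoc _ _ _).hom ≫ (𝟙 (F.Fp.obj A) ⊗ₕ F.mTen B C) ≫ F.νpL A (B ⊗ₒ C) =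
      (F.νpL A B ⊗ₕ 𝟙 (F.Ft.obj C)) ≫ F.νpL (A ⊗ₒ B) C ≫ F.Fp.map (tAssoc A B C).hom
  -- linear distributivities
  νtR_δR (A B C : X) :
    F.mTen (A ⊕ₒ B) C ≫ F.Ft.map (δR A B C) ≫ F.νtR A (B ⊗ₒ C) =
      (F.νtR A B ⊗ₕ 𝟙 (F.Ft.obj C)) ≫ δR _ _ _ ≫ (𝟙 (F.Fp.obj A) ⊕ₕ F.mTen B C)
  νtL_δL (A B C : X) :
    F.mTen A (B ⊕ₒ C) ≫ F.Ft.map (δL A B C) ≫ F.νtL (A ⊗ₒ B) C =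
      (𝟙 (F.Ft.obj A) ⊗ₕ F.νtL B C) ≫ δL _ _ _ ≫ (F.mTen A B ⊕ₕ 𝟙 (F.Fp.obj C))
  νpR_δL (A B C : X) :
    F.νpR A (B ⊕ₒ C) ≫ F.Fp.map (δL A B C) ≫ F.nPar (A ⊗ₒ B) C =
      (𝟙 (F.Ft.obj A) ⊗ₕ F.nPar B C) ≫ δL _ _ _ ≫ (F.νpR A B ⊕ₕ 𝟙 (F.Fp.obj C))
  νpL_δR (A B C : X) :
    F.νpL (A ⊕ₒ B) C ≫ F.Fp.map (δR A B C) ≫ F.nPar A (B ⊗ₒ C) =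
      (F.nPar A B ⊗ₕ 𝟙 (F.Ft.obj C)) ≫ δR _ _ _ ≫ (𝟙 (F.Fp.obj A) ⊕ₕ F.νpL B C)
  -- the other linear strengths via associators
  νtR_νtL (A B C : X) :
    F.νtR A (B ⊕ₒ C) ≫ (𝟙 (F.Fp.obj A) ⊕ₕ F.νtL B C) ≫ (pAssoc _ _ _).hom =
      F.Ft.map (pAssoc A B C).hom ≫ F.νtL (A ⊕ₒ B) C ≫ (F.νtR A B ⊕ₕ 𝟙 (F.Fp.obj C))
  νpL_νpR (A B C : X) :
    (tAssoc _ _ _).hom ≫ (𝟙 (F.Ft.obj A) ⊗ₕ F.νpL B C) ≫ F.νpR A (B ⊗ₒ C) =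
      (F.νpR A B ⊗ₕ 𝟙 (F.Ft.obj C)) ≫ F.νpL (A ⊗ₒ B) C ≫ F.Fp.map (tAssoc A B C).hom
  -- the other linear strengths via linear distributivities
  νtR_δL (A B C : X) :
    F.mTen A (B ⊕ₒ C) ≫ F.Ft.map (δL A B C) ≫ F.νtR (A ⊗ₒ B) C =
      (𝟙 (F.Ft.obj A) ⊗ₕ F.νtR B C) ≫ δL _ _ _ ≫ (F.νpR A B ⊕ₕ 𝟙 (F.Ft.obj C))
  νtL_δR (A B C : X) :
    F.mTen (A ⊕ₒ B) C ≫ F.Ft.map (δR A B C) ≫ F.νtL A (B ⊗ₒ C) =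
      (F.νtL A B ⊗ₕ 𝟙 (F.Ft.obj C)) ≫ δR _ _ _ ≫ (𝟙 (F.Ft.obj A) ⊕ₕ F.νpL B C)
  νpR_δR (A B C : X) :
    F.νpR (A ⊕ₒ B) C ≫ F.Fp.map (δR A B C) ≫ F.nPar A (B ⊗ₒ C) =
      (F.νtR A B ⊗ₕ 𝟙 (F.Fp.obj C)) ≫ δR _ _ _ ≫ (𝟙 (F.Fp.obj A) ⊕ₕ F.νpR B C)
  νpL_δL (A B C : X) :
    F.νpL A (B ⊕ₒ C) ≫ F.Fp.map (δL A B C) ≫ F.nPar (A ⊗ₒ B) C =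
      (𝟙 (F.Fp.obj A) ⊗ₕ F.νtL B C) ≫ δL _ _ _ ≫ (F.νpL A B ⊕ₕ 𝟙 (F.Fp.obj C))

end LinearFunctorData

/-- The data form a symmetric linear functor (on top of `IsLinear`): the (co)monoidal functors are
symmetric and the linear strengths are compatible with the braidings. -/
structure LinearFunctorData.IsSymmetric [SymmetricMLDC X] [SymmetricMLDC Y]
    (F : LinearFunctorData X Y) : Prop where
  mTen_braid (A B : X) :
    F.mTen A B ≫ F.Ft.map (tBraid A B).hom = (tBraid _ _).hom ≫ F.mTen B A
  nPar_braid (A B : X) :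
    F.Fp.map (pBraid A B).hom ≫ F.nPar B A = F.nPar A B ≫ (pBraid _ _).hom
  νt_braid (A B : X) :
    F.νtR A B ≫ (pBraid _ _).hom = F.Ft.map (pBraid A B).hom ≫ F.νtL B A
  νp_braid (A B : X) :
    F.νpR A B ≫ F.Fp.map (tBraid A B).hom = (tBraid _ _).hom ≫ F.νpL B A

/-! ### Medial linear functors -/

namespace MedialFunctorData

section

variable [LDC X] [LDC Y] (F : MedialFunctorData X Y)

/-- `m_⊥`. -/
abbrev mBot : bot Y ⟶ F.Ft.obj (bot X) := F.pLax.ε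

/-- `m_⊕`. -/
abbrev mPar (A B : X) : F.Ft.obj A ⊕ₒ F.Ft.obj B ⟶ F.Ft.obj (A ⊕ₒ B) := F.pLax.μ A B

/-- `n_⊤`. -/
abbrev nTop : F.Fp.obj (top X) ⟶ top Y := F.tOplax.η

/-- `n_⊗`. -/
abbrev nTen (A B : X) : F.Fp.obj (A ⊗ₒ B) ⟶ F.Fp.obj A ⊗ₒ F.Fp.obj B := F.tOplax.δ A B

end

/-- The data form a strong symmetric medial linear functor. -/
structure IsMedial [SymmetricMLDC X] [SymmetricMLDC Y] (F : MedialFunctorData X Y) : Prop where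
  -- `F` is a symmetric linear functor
  isLinear : F.toLinearFunctorData.IsLinear
  isSymmetric : F.toLinearFunctorData.IsSymmetric
  -- strength
  mTop_iso : IsIso F.mTop
  mTen_iso : ∀ A B : X, IsIso (F.mTen A B)
  nBot_iso : IsIso F.nBot
  nPar_iso : ∀ A B : X, IsIso (F.nPar A B)
  -- the additional (co)monoidal structures are symmetric
  mPar_braid (A B : X) :
    F.mPar A B ≫ F.Ft.map (pBraid A B).hom = (pBraid _ _).hom ≫ F.mPar B A
  nTen_braid (A B : X) :
    F.Fp.map (tBraid A B).hom ≫ F.nTen B A = F.nTen A B ≫ (tBraid _ _).hom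
  -- `F_⊗` with `m_⊥, m_⊕` and the inverses of `m_⊤, m_⊗` is a bilax duoidal functor
  mBot_Δbot : Δbot ≫ (F.mBot ⊗ₕ F.mBot) ≫ F.mTen (bot X) (bot X) = F.mBot ≫ F.Ft.map Δbot
  mTop_nablaTop :
    (F.mTop ⊕ₕ F.mTop) ≫ F.mPar (top X) (top X) ≫ F.Ft.map nablaTop = nablaTop ≫ F.mTop
  mix_mTop : mix ≫ F.mTop = F.mBot ≫ F.Ft.map mix
  mTen_μ (A B C D : X) :
    (F.mTen A B ⊕ₕ F.mTen C D) ≫ F.mPar (A ⊗ₒ B) (C ⊗ₒ D) ≫ F.Ft.map (μ A B C D) =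
      μ _ _ _ _ ≫ (F.mPar A C ⊗ₕ F.mPar B D) ≫ F.mTen (A ⊕ₒ C) (B ⊕ₒ D)
  -- `F_⊕` with `n_⊤, n_⊗` and the inverses of `n_⊥, n_⊕` is a bilax duoidal functor
  nBot_Δbot : F.Fp.map Δbot ≫ F.nTen (bot X) (bot X) ≫ (F.nBot ⊗ₕ F.nBot) = F.nBot ≫ Δbot
  nTop_nablaTop :
    F.nPar (top X) (top X) ≫ (F.nTop ⊕ₕ F.nTop) ≫ nablaTop = F.Fp.map nablaTop ≫ F.nTop
  nBot_mix : F.nBot ≫ mix = F.Fp.map mix ≫ F.nTop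
  nPar_μ (A B C D : X) :
    F.Fp.map (μ A B C D) ≫ F.nTen (A ⊕ₒ C) (B ⊕ₒ D) ≫ (F.nPar A C ⊗ₕ F.nPar B D) =
      F.nPar (A ⊗ₒ B) (C ⊗ₒ D) ≫ (F.nTen A B ⊕ₕ F.nTen C D) ≫ μ _ _ _ _
  -- linear strengths, `⊥`-contraction and `⊤`-cocontraction
  νpR_Δbot :
    F.Fp.map Δbot = F.nBot ≫ Δbot ≫ (F.mBot ⊗ₕ inv F.nBot) ≫ F.νpR (bot X) (bot X)
  νtR_nablaTop :
    F.Ft.map nablaTop = F.νtR (top X) (top X) ≫ (F.nTop ⊕ₕ inv F.mTop) ≫ nablaTop ≫ F.mTop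
  -- linear strengths and medial maps
  νtR_μ (A B C D : X) :
    F.Ft.map (μ A B C D) ≫ inv (F.mTen (A ⊕ₒ C) (B ⊕ₒ D)) ≫ (F.νtR A C ⊗ₕ F.νtR B D) =
      F.νtR (A ⊗ₒ B) (C ⊗ₒ D) ≫ (F.nTen A B ⊕ₕ inv (F.mTen C D)) ≫ μ _ _ _ _
  νpR_μ (A B C D : X) :
    (F.νpR A B ⊕ₕ F.νpR C D) ≫ inv (F.nPar (A ⊗ₒ B) (C ⊗ₒ D)) ≫ F.Fp.map (μ A B C D) =
      μ _ _ _ _ ≫ (F.mPar A C ⊗ₕ inv (F.nPar B D)) ≫ F.νpR (A ⊕ₒ C) (B ⊕ₒ D)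
  -- linear strengths, `m_⊕` and `n_⊗`
  νtR_mPar (A B C : X) :
    F.mPar (A ⊕ₒ B) C ≫ F.Ft.map (pAssoc A B C).inv ≫ F.νtR A (B ⊕ₒ C) =
      (F.νtR A B ⊕ₕ 𝟙 (F.Ft.obj C)) ≫ (pAssoc _ _ _).inv ≫ (𝟙 (F.Fp.obj A) ⊕ₕ F.mPar B C)
  νpR_nTen (A B C : X) :
    F.νpR A (B ⊗ₒ C) ≫ F.Fp.map (tAssoc A B C).inv ≫ F.nTen (A ⊗ₒ B) C =
      (𝟙 (F.Ft.obj A) ⊗ₕ F.nTen B C) ≫ (tAssoc _ _ _).inv ≫ (F.νpR A B ⊗ₕ 𝟙 (F.Fp.obj C))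

variable (X) in
/-- The identity functor, with identity structure maps. -/
def id [LDC X] : MedialFunctorData X X where
  Ft := 𝟭 X
  Fp := 𝟭 X
  tLax := @Functor.LaxMonoidal.id X _ TwoMonoidal.ten
  pOplax := @Functor.OplaxMonoidal.id X _ TwoMonoidal.par
  pLax := @Functor.LaxMonoidal.id X _ TwoMonoidal.par
  tOplax := @Functor.OplaxMonoidal.id X _ TwoMonoidal.ten
  νtR A B := 𝟙 (A ⊕ₒ B)
  νtL A B := 𝟙 (A ⊕ₒ B)
  νpR A B := 𝟙 (A ⊗ₒ B)
  νpL A B := 𝟙 (A ⊗ₒ B)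

/-- The composite `F ; G = (F_⊗ ; G_⊗, F_⊕ ; G_⊕)`, with the composite (co)monoidal structures and
linear strengths. -/
def comp {Z : Type u} [Category.{v} Z] [LDC X] [LDC Y] [LDC Z]
    (F : MedialFunctorData X Y) (G : MedialFunctorData Y Z) : MedialFunctorData X Z where
  Ft := F.Ft ⋙ G.Ft
  Fp := F.Fp ⋙ G.Fp
  tLax := @Functor.LaxMonoidal.comp _ _ TwoMonoidal.ten _ _ TwoMonoidal.ten _ _ TwoMonoidal.ten
    F.Ft G.Ft F.tLax G.tLax
  pOplax := @Functor.OplaxMonoidal.comp _ _ TwoMonoidal.par _ _ TwoMonoidal.par _ _ TwoMonoidal.par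
    F.Fp G.Fp F.pOplax G.pOplax
  pLax := @Functor.LaxMonoidal.comp _ _ TwoMonoidal.par _ _ TwoMonoidal.par _ _ TwoMonoidal.par
    F.Ft G.Ft F.pLax G.pLax
  tOplax := @Functor.OplaxMonoidal.comp _ _ TwoMonoidal.ten _ _ TwoMonoidal.ten _ _ TwoMonoidal.ten
    F.Fp G.Fp F.tOplax G.tOplax
  νtR A B := G.Ft.map (F.νtR A B) ≫ G.νtR (F.Fp.obj A) (F.Ft.obj B)
  νtL A B := G.Ft.map (F.νtL A B) ≫ G.νtL (F.Ft.obj A) (F.Fp.obj B)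
  νpR A B := G.νpR (F.Ft.obj A) (F.Fp.obj B) ≫ G.Fp.map (F.νpR A B)
  νpL A B := G.νpL (F.Fp.obj A) (F.Ft.obj B) ≫ G.Fp.map (F.νpL A B)

section Strictness

variable {Z : Type u} [Category.{v} Z] {W : Type u} [Category.{v} W]
  [LDC X] [LDC Y] [LDC Z] [LDC W]

theorem id_comp (F : MedialFunctorData X Y) : (id X).comp F = F := by
  have l (H : X ⥤ Y) {A : X} {B : Y} (f : B ⟶ H.obj A) : f ≫ H.map (𝟙 A) = f := by simp
  have o (H : X ⥤ Y) {A : X} {B : Y} (f : H.obj A ⟶ B) : H.map (𝟙 A) ≫ f = f := by simp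
  obtain ⟨⟨Ft, Fp, _, _, _, _, _, _⟩, _, _⟩ := F
  simp only [comp, id, mk.injEq, LinearFunctorData.mk.injEq]
  exact ⟨⟨rfl, rfl,
    heq_of_eq (Functor.LaxMonoidal.ext (l Ft _) (funext₂ fun _ _ => l Ft _)),
    heq_of_eq (Functor.OplaxMonoidal.ext (o Fp _) (funext₂ fun _ _ => o Fp _)),
    heq_of_eq (funext₂ fun _ _ => o Ft _), heq_of_eq (funext₂ fun _ _ => o Ft _),
    heq_of_eq (funext₂ fun _ _ => l Fp _), heq_of_eq (funext₂ fun _ _ => l Fp _)⟩,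
    heq_of_eq (Functor.LaxMonoidal.ext (l Ft _) (funext₂ fun _ _ => l Ft _)),
    heq_of_eq (Functor.OplaxMonoidal.ext (o Fp _) (funext₂ fun _ _ => o Fp _))⟩

theorem comp_id (F : MedialFunctorData X Y) : F.comp (id Y) = F := by
  have l {A B : Y} (f : A ⟶ B) : 𝟙 A ≫ f = f := Category.id_comp f
  have o {A B : Y} (f : A ⟶ B) : f ≫ 𝟙 B = f := Category.comp_id f
  obtain ⟨⟨Ft, Fp, _, _, _, _, _, _⟩, _, _⟩ := F
  simp only [comp, id, mk.injEq, LinearFunctorData.mk.injEq]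
  exact ⟨⟨rfl, rfl,
    heq_of_eq (Functor.LaxMonoidal.ext (l _) (funext₂ fun _ _ => l _)),
    heq_of_eq (Functor.OplaxMonoidal.ext (o _) (funext₂ fun _ _ => o _)),
    heq_of_eq (funext₂ fun _ _ => o _), heq_of_eq (funext₂ fun _ _ => o _),
    heq_of_eq (funext₂ fun _ _ => l _), heq_of_eq (funext₂ fun _ _ => l _)⟩,
    heq_of_eq (Functor.LaxMonoidal.ext (l _) (funext₂ fun _ _ => l _)),
    heq_of_eq (Functor.OplaxMonoidal.ext (o _) (funext₂ fun _ _ => o _))⟩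

theorem assoc (F : MedialFunctorData X Y) (G : MedialFunctorData Y Z) (H : MedialFunctorData Z W) :
    (F.comp G).comp H = F.comp (G.comp H) := by
  have l (K : Z ⥤ W) {A : W} {B C D : Z} (f : A ⟶ K.obj B) (g : B ⟶ C) (k : C ⟶ D) :
      f ≫ K.map (g ≫ k) = (f ≫ K.map g) ≫ K.map k := by simp
  have o (K : Z ⥤ W) {A : W} {B C D : Z} (f : K.obj B ⟶ A) (g : C ⟶ B) (k : D ⟶ C) :
      K.map (k ≫ g) ≫ f = K.map k ≫ K.map g ≫ f := by simp
  simp only [comp, mk.injEq, LinearFunctorData.mk.injEq]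
  exact ⟨⟨rfl, rfl,
    heq_of_eq (Functor.LaxMonoidal.ext (l H.Ft _ _ _) (funext₂ fun _ _ => l H.Ft _ _ _)),
    heq_of_eq (Functor.OplaxMonoidal.ext (o H.Fp _ _ _) (funext₂ fun _ _ => o H.Fp _ _ _)),
    heq_of_eq (funext₂ fun _ _ => o H.Ft _ _ _), heq_of_eq (funext₂ fun _ _ => o H.Ft _ _ _),
    heq_of_eq (funext₂ fun _ _ => l H.Fp _ _ _), heq_of_eq (funext₂ fun _ _ => l H.Fp _ _ _)⟩,
    heq_of_eq (Functor.LaxMonoidal.ext (l H.Ft _ _ _) (funext₂ fun _ _ => l H.Ft _ _ _)),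
    heq_of_eq (Functor.OplaxMonoidal.ext (o H.Fp _ _ _) (funext₂ fun _ _ => o H.Fp _ _ _))⟩

end Strictness

end MedialFunctorData

end Functors

/-! ### Medial linear transformations -/

section Transformations

variable {X : Type u} [Category.{v} X] {Y : Type u} [Category.{v} Y]
  {Z : Type u} [Category.{v} Z]

/-- A pair of natural transformations `α_⊗ : F_⊗ ⟶ G_⊗` and `α_⊕ : G_⊕ ⟶ F_⊕`. -/
@[ext]
structure TransData [LDC X] [LDC Y] (F G : MedialFunctorData X Y) where
  /-- `α_⊗` -/
  t : F.Ft ⟶ G.Ft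
  /-- `α_⊕` -/
  p : G.Fp ⟶ F.Fp

namespace TransData

variable [LDC X] [LDC Y] [LDC Z]

/-- The pair is a strong medial linear transformation. -/
structure IsMedial {F G : MedialFunctorData X Y} (α : TransData F G) : Prop where
  -- `α_⊗` is a monoidal transformation for the tensors
  t_mTop : F.mTop ≫ α.t.app (top X) = G.mTop
  t_mTen (A B : X) : F.mTen A B ≫ α.t.app (A ⊗ₒ B) = (α.t.app A ⊗ₕ α.t.app B) ≫ G.mTen A B
  -- `α_⊗` is a monoidal transformation for the pars
  t_mBot : F.mBot ≫ α.t.app (bot X) = G.mBot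
  t_mPar (A B : X) : F.mPar A B ≫ α.t.app (A ⊕ₒ B) = (α.t.app A ⊕ₕ α.t.app B) ≫ G.mPar A B
  -- `α_⊕` is a comonoidal transformation for the pars
  p_nBot : α.p.app (bot X) ≫ F.nBot = G.nBot
  p_nPar (A B : X) : α.p.app (A ⊕ₒ B) ≫ F.nPar A B = G.nPar A B ≫ (α.p.app A ⊕ₕ α.p.app B)
  -- `α_⊕` is a comonoidal transformation for the tensors
  p_nTop : α.p.app (top X) ≫ F.nTop = G.nTop
  p_nTen (A B : X) : α.p.app (A ⊗ₒ B) ≫ F.nTen A B = G.nTen A B ≫ (α.p.app A ⊗ₕ α.p.app B)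
  -- compatibility with the linear strengths
  νtR (A B : X) :
    α.t.app (A ⊕ₒ B) ≫ G.νtR A B ≫ (α.p.app A ⊕ₕ 𝟙 (G.Ft.obj B)) =
      F.νtR A B ≫ (𝟙 (F.Fp.obj A) ⊕ₕ α.t.app B)
  νtL (A B : X) :
    α.t.app (A ⊕ₒ B) ≫ G.νtL A B ≫ (𝟙 (G.Ft.obj A) ⊕ₕ α.p.app B) =
      F.νtL A B ≫ (α.t.app A ⊕ₕ 𝟙 (F.Fp.obj B))
  νpL (A B : X) :
    (𝟙 (G.Fp.obj A) ⊗ₕ α.t.app B) ≫ G.νpL A B ≫ α.p.app (A ⊗ₒ B) =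
      (α.p.app A ⊗ₕ 𝟙 (F.Ft.obj B)) ≫ F.νpL A B
  νpR (A B : X) :
    (α.t.app A ⊗ₕ 𝟙 (G.Fp.obj B)) ≫ G.νpR A B ≫ α.p.app (A ⊗ₒ B) =
      (𝟙 (F.Ft.obj A) ⊗ₕ α.p.app B) ≫ F.νpR A B

/-- The identity transformation. -/
def id (F : MedialFunctorData X Y) : TransData F F := ⟨𝟙 F.Ft, 𝟙 F.Fp⟩

/-- Vertical composition. -/
def comp {F G H : MedialFunctorData X Y} (α : TransData F G) (β : TransData G H) :
    TransData F H := ⟨α.t ≫ β.t, β.p ≫ α.p⟩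

/-- Horizontal composition. -/
def hcomp {F F' : MedialFunctorData X Y} {G G' : MedialFunctorData Y Z}
    (α : TransData F F') (β : TransData G G') : TransData (F.comp G) (F'.comp G') :=
  ⟨NatTrans.hcomp α.t β.t, NatTrans.hcomp α.p β.p⟩

/-- Left whiskering, i.e. horizontal composition with the identity of `F`. -/
def whiskerLeft (F : MedialFunctorData X Y) {G G' : MedialFunctorData Y Z} (β : TransData G G') :
    TransData (F.comp G) (F.comp G') :=
  ⟨Functor.whiskerLeft F.Ft β.t, Functor.whiskerLeft F.Fp β.p⟩

/-- Right whiskering, i.e. horizontal composition with the identity of `G`. -/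
def whiskerRight {F F' : MedialFunctorData X Y} (α : TransData F F') (G : MedialFunctorData Y Z) :
    TransData (F.comp G) (F'.comp G) :=
  ⟨Functor.whiskerRight α.t G.Ft, Functor.whiskerRight α.p G.Fp⟩

end TransData

end Transformations

/-! ### The 2-category -/

set_option linter.checkUnivs false in
/-- The type of symmetric medial linearly distributive categories: the 0-cells. -/
structure SMLDC where
  /-- the underlying type of objects -/
  carrier : Type u
  [cat : Category.{v} carrier]
  [str : SymmetricMLDC carrier]

attribute [instance] SMLDC.cat SMLDC.str

/-- Strong symmetric medial linear functors: the 1-cells. -/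
@[ext]
structure MedialLinearFunctor (X Y : SMLDC.{v, u}) where
  /-- the functors and structure maps -/
  data : MedialFunctorData X.carrier Y.carrier
  isMedial : data.IsMedial

/-- Strong medial linear transformations: the 2-cells. -/
@[ext]
structure MedialLinearTransformation {X Y : SMLDC.{v, u}} (F G : MedialLinearFunctor X Y) where
  /-- the pair of natural transformations -/
  data : TransData F.data G.data
  isMedial : data.IsMedial

/-- Identities and composites of medial linear functors and of medial linear transformations are
again medial linear functors and medial linear transformations. -/
structure SMLDC.IsClosed : Prop where
  id_functor (X : SMLDC.{v, u}) : (MedialFunctorData.id X.carrier).IsMedial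
  comp_functor {X Y Z : SMLDC.{v, u}} (F : MedialLinearFunctor X Y) (G : MedialLinearFunctor Y Z) :
    (F.data.comp G.data).IsMedial
  id_trans {X Y : SMLDC.{v, u}} (F : MedialLinearFunctor X Y) : (TransData.id F.data).IsMedial
  comp_trans {X Y : SMLDC.{v, u}} {F G H : MedialLinearFunctor X Y}
    (α : MedialLinearTransformation F G) (β : MedialLinearTransformation G H) :
    (α.data.comp β.data).IsMedial
  hcomp_trans {X Y Z : SMLDC.{v, u}} {F F' : MedialLinearFunctor X Y}
    {G G' : MedialLinearFunctor Y Z} (α : MedialLinearTransformation F F')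
    (β : MedialLinearTransformation G G') : (α.data.hcomp β.data).IsMedial
  whiskerLeft_trans {X Y Z : SMLDC.{v, u}} (F : MedialLinearFunctor X Y)
    {G G' : MedialLinearFunctor Y Z} (β : MedialLinearTransformation G G') :
    (TransData.whiskerLeft F.data β.data).IsMedial
  whiskerRight_trans {X Y Z : SMLDC.{v, u}} {F F' : MedialLinearFunctor X Y}
    (α : MedialLinearTransformation F F') (G : MedialLinearFunctor Y Z) :
    (TransData.whiskerRight α.data G.data).IsMedial

namespace SMLDC

/-- The 1-cells with their identities and composition. -/
abbrev oneCells (h : IsClosed.{v, u}) : CategoryStruct SMLDC.{v, u} where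
  Hom X Y := MedialLinearFunctor X Y
  id X := ⟨MedialFunctorData.id X.carrier, h.id_functor X⟩
  comp F G := ⟨F.data.comp G.data, h.comp_functor F G⟩

/-- The category of 1-cells `X ⟶ Y` and 2-cells, with vertical composition. -/
abbrev homCategory (h : IsClosed.{v, u}) (X Y : SMLDC.{v, u}) :
    Category (MedialLinearFunctor X Y) where
  Hom F G := MedialLinearTransformation F G
  id F := ⟨TransData.id F.data, h.id_trans F⟩
  comp α β := ⟨α.data.comp β.data, h.comp_trans α β⟩
  id_comp α := by
    ext <;> simp [TransData.id, TransData.comp]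
  comp_id α := by
    ext <;> simp [TransData.id, TransData.comp]
  assoc α β γ := by
    ext <;> simp [TransData.comp]

/-- The pair of identities is a medial linear transformation `F ⟶ F'` when `F = F'`. -/
theorem isMedial_of_eq {X Y : Type u} [Category.{v} X] [LDC X] [Category.{v} Y] [LDC Y]
    {F F' : MedialFunctorData X Y} (e : F = F') (α : TransData F F')
    (ht : α.t = eqToHom (by rw [e])) (hp : α.p = eqToHom (by rw [e])) : α.IsMedial := by
  subst e
  constructor <;> intros <;> simp [ht, hp]

theorem twoCell_ext {X Y : SMLDC.{v, u}} {F G : MedialLinearFunctor X Y}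
    {α β : MedialLinearTransformation F G}
    (ht : ∀ A, α.data.t.app A = β.data.t.app A) (hp : ∀ A, α.data.p.app A = β.data.p.app A) :
    α = β :=
  MedialLinearTransformation.ext
    (TransData.ext (NatTrans.ext (funext ht)) (NatTrans.ext (funext hp)))

/-- SMLDCs, medial linear functors and medial linear transformations, with the identities and
compositions of `IsClosed`; the unitors and associators have identity components. -/
abbrev bicategory (h : IsClosed.{v, u}) : Bicategory.{max u v, max u v} SMLDC.{v, u} :=
  letI := oneCells h
  letI := fun X Y => homCategory h X Y
  { oneCells h with
    homCategory := homCategory h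
    whiskerLeft := fun F _ _ β => ⟨TransData.whiskerLeft F.data β.data, h.whiskerLeft_trans F β⟩
    whiskerRight := fun α G => ⟨TransData.whiskerRight α.data G.data, h.whiskerRight_trans α G⟩
    leftUnitor := fun F => @Iso.mk _ (homCategory h _ _) _ _
      ⟨⟨𝟙 F.data.Ft, 𝟙 F.data.Fp⟩, isMedial_of_eq F.data.id_comp _ rfl rfl⟩
      ⟨⟨𝟙 F.data.Ft, 𝟙 F.data.Fp⟩, isMedial_of_eq F.data.id_comp.symm _ rfl rfl⟩
      (twoCell_ext (fun _ => Category.comp_id _) (fun _ => Category.comp_id _))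
      (twoCell_ext (fun _ => Category.comp_id _) (fun _ => Category.comp_id _))
    rightUnitor := fun F => @Iso.mk _ (homCategory h _ _) _ _
      ⟨⟨𝟙 F.data.Ft, 𝟙 F.data.Fp⟩, isMedial_of_eq F.data.comp_id _ rfl rfl⟩
      ⟨⟨𝟙 F.data.Ft, 𝟙 F.data.Fp⟩, isMedial_of_eq F.data.comp_id.symm _ rfl rfl⟩
      (twoCell_ext (fun _ => Category.comp_id _) (fun _ => Category.comp_id _))
      (twoCell_ext (fun _ => Category.comp_id _) (fun _ => Category.comp_id _))
    associator := fun F G H => @Iso.mk _ (homCategory h _ _) _ _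
      ⟨⟨𝟙 (F.data.Ft ⋙ G.data.Ft ⋙ H.data.Ft), 𝟙 (F.data.Fp ⋙ G.data.Fp ⋙ H.data.Fp)⟩,
        isMedial_of_eq (F.data.assoc G.data H.data) _ rfl rfl⟩
      ⟨⟨𝟙 (F.data.Ft ⋙ G.data.Ft ⋙ H.data.Ft), 𝟙 (F.data.Fp ⋙ G.data.Fp ⋙ H.data.Fp)⟩,
        isMedial_of_eq (F.data.assoc G.data H.data).symm _ rfl rfl⟩
      (twoCell_ext (fun _ => Category.comp_id _) (fun _ => Category.comp_id _))
      (twoCell_ext (fun _ => Category.comp_id _) (fun _ => Category.comp_id _))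
    whiskerLeft_id := fun _ _ => twoCell_ext (fun _ => rfl) (fun _ => rfl)
    whiskerLeft_comp := fun _ _ _ _ _ _ => twoCell_ext (fun _ => rfl) (fun _ => rfl)
    id_whiskerLeft := fun η => twoCell_ext
      (fun A => ((Category.id_comp _).trans (Category.comp_id (η.data.t.app A))).symm)
      (fun A => ((Category.assoc _ _ _).trans
        ((Category.id_comp _).trans (Category.comp_id (η.data.p.app A)))).symm)
    comp_whiskerLeft := fun _ _ _ _ η => twoCell_ext
      (fun _ => ((Category.id_comp _).trans (Category.comp_id (η.data.t.app _))).symm)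
      (fun _ => ((Category.assoc _ _ _).trans
        ((Category.id_comp _).trans (Category.comp_id (η.data.p.app _)))).symm)
    id_whiskerRight := fun _ G => twoCell_ext (fun _ => G.data.Ft.map_id _)
      (fun _ => G.data.Fp.map_id _)
    comp_whiskerRight := fun _ _ G => twoCell_ext (fun _ => G.data.Ft.map_comp _ _)
      (fun _ => G.data.Fp.map_comp _ _)
    whiskerRight_id := fun η => twoCell_ext
      (fun A => ((Category.id_comp _).trans (Category.comp_id (η.data.t.app A))).symm)
      (fun A => ((Category.assoc _ _ _).trans
        ((Category.id_comp _).trans (Category.comp_id (η.data.p.app A)))).symm)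
    whiskerRight_comp := fun _ _ _ => twoCell_ext
      (fun _ => ((Category.id_comp _).trans (Category.comp_id _)).symm)
      (fun _ => ((Category.assoc _ _ _).trans
        ((Category.id_comp _).trans (Category.comp_id _))).symm)
    whisker_assoc := fun _ _ _ _ _ => twoCell_ext
      (fun _ => ((Category.id_comp _).trans (Category.comp_id _)).symm)
      (fun _ => ((Category.assoc _ _ _).trans
        ((Category.id_comp _).trans (Category.comp_id _))).symm)
    whisker_exchange := fun η θ => twoCell_ext
      (fun A => (θ.data.t.naturality (η.data.t.app A)).symm)
      (fun A => θ.data.p.naturality (η.data.p.app A))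
    pentagon := fun _ _ _ K => twoCell_ext
      (fun _ => (congrArg (· ≫ 𝟙 _ ≫ 𝟙 _) (K.data.Ft.map_id _)).trans (Category.id_comp _))
      (fun _ => (congrArg ((𝟙 _ ≫ 𝟙 _) ≫ ·) (K.data.Fp.map_id _)).trans (Category.comp_id _))
    triangle := fun _ G => twoCell_ext
      (fun _ => (Category.id_comp _).trans (G.data.Ft.map_id _).symm)
      (fun _ => (Category.id_comp _).trans (G.data.Fp.map_id _).symm) }

end SMLDC

end MedialLD

/-! The bicategory is already determined once closure is known, so the substance is `IsClosed`,
together with strictness and the description of horizontal composition.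

Closure of 1-cells rests on one pasting argument. A structure map of `F ; G` is a structure map of
`G` composed with the `G`-image of a structure map of `F`. In each coherence diagram for the
composite, naturality of the structure maps of `G` slides the `G`-images together. The diagram then
splits into two pieces: the same axiom for `G`, taken at objects in the image of `F`, and the
`G`-image of the same axiom for `F`. For the clauses that contain inverses, the naturality squares
of `m_⊗` and `n_⊕` are inverted first. This gives `isLinear_comp` and
`MedialFunctorData.isMedial_comp`. For identities every structure map is an identity and nothing
remains.

For 2-cells, vertical composites paste the squares of the two factors, with an interchange for the
strengths. Left whiskering uses naturality of the transformation, right whiskering naturality of the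
structure maps of the functor. Horizontal composites factor through the two whiskerings.

Strictness holds because composition of functors is definitionally unital and associative. The
unitors and associators have identity components, so they are the canonical 2-cells along the
equalities of 1-cells. -/

namespace MedialLD

open LDC MLDC

/-! ### Bifunctoriality of the tensor and the par -/

section Interchange

variable {X : Type u} [Category.{v} X] [TwoMonoidal X]

theorem tHom_id (A B : X) : 𝟙 A ⊗ₕ 𝟙 B = 𝟙 (A ⊗ₒ B) :=
  (TwoMonoidal.ten (X := X)).id_tensorHom_id A B

theorem pHom_id (A B : X) : 𝟙 A ⊕ₕ 𝟙 B = 𝟙 (A ⊕ₒ B) :=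
  (TwoMonoidal.par (X := X)).id_tensorHom_id A B

theorem tHom_comp {A A' A'' B B' B'' : X} (f : A ⟶ A') (f' : A' ⟶ A'') (g : B ⟶ B')
    (g' : B' ⟶ B'') : (f ⊗ₕ g) ≫ (f' ⊗ₕ g') = (f ≫ f') ⊗ₕ (g ≫ g') :=
  (TwoMonoidal.ten (X := X)).tensorHom_comp_tensorHom f g f' g'

theorem pHom_comp {A A' A'' B B' B'' : X} (f : A ⟶ A') (f' : A' ⟶ A'') (g : B ⟶ B')
    (g' : B' ⟶ B'') : (f ⊕ₕ g) ≫ (f' ⊕ₕ g') = (f ≫ f') ⊕ₕ (g ≫ g') :=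
  (TwoMonoidal.par (X := X)).tensorHom_comp_tensorHom f g f' g'

/-- Composite structure maps occur in the axioms tensored or parred with an identity. This law and
its three variants break them into factors, so that the part from `G` and the part from `F` can be
moved separately. -/
theorem comp_tHom_id {A B C : X} (f : A ⟶ B) (g : B ⟶ C) (D : X) :
    (f ≫ g) ⊗ₕ 𝟙 D = (f ⊗ₕ 𝟙 D) ≫ (g ⊗ₕ 𝟙 D) := by
  rw [tHom_comp, Category.comp_id]

theorem id_tHom_comp {A B C : X} (D : X) (f : A ⟶ B) (g : B ⟶ C) :
    𝟙 D ⊗ₕ (f ≫ g) = (𝟙 D ⊗ₕ f) ≫ (𝟙 D ⊗ₕ g) := by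
  rw [tHom_comp, Category.comp_id]

theorem comp_pHom_id {A B C : X} (f : A ⟶ B) (g : B ⟶ C) (D : X) :
    (f ≫ g) ⊕ₕ 𝟙 D = (f ⊕ₕ 𝟙 D) ≫ (g ⊕ₕ 𝟙 D) := by
  rw [pHom_comp, Category.comp_id]

theorem id_pHom_comp {A B C : X} (D : X) (f : A ⟶ B) (g : B ⟶ C) :
    𝟙 D ⊕ₕ (f ≫ g) = (𝟙 D ⊕ₕ f) ≫ (𝟙 D ⊕ₕ g) := by
  rw [pHom_comp, Category.comp_id]

/-- For vertical composition of 2-cells: the strength squares of the two factors can be pasted only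
after a component of one transformation has passed a component of the other in the opposite slot. -/
theorem tHom_exchange {A A' B B' : X} (f : A ⟶ A') (g : B ⟶ B') :
    (𝟙 A ⊗ₕ g) ≫ (f ⊗ₕ 𝟙 B') = (f ⊗ₕ 𝟙 B) ≫ (𝟙 A' ⊗ₕ g) := by
  simp only [tHom_comp, Category.id_comp, Category.comp_id]

theorem pHom_exchange {A A' B B' : X} (f : A ⟶ A') (g : B ⟶ B') :
    (𝟙 A ⊕ₕ g) ≫ (f ⊕ₕ 𝟙 B') = (f ⊕ₕ 𝟙 B) ≫ (𝟙 A' ⊕ₕ g) := by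
  simp only [pHom_comp, Category.id_comp, Category.comp_id]

end Interchange

/-! ### The identity 1-cell -/

namespace MedialFunctorData

section Id

variable (X : Type u) [Category.{v} X]

section

variable [LDC X]

theorem id_Ft : (id X).Ft = 𝟭 X := rfl
theorem id_Fp : (id X).Fp = 𝟭 X := rfl
theorem id_mTop : (id X).mTop = 𝟙 (top X) := rfl
theorem id_mTen (A B : X) : (id X).mTen A B = 𝟙 (A ⊗ₒ B) := rfl
theorem id_mBot : (id X).mBot = 𝟙 (bot X) := rfl
theorem id_mPar (A B : X) : (id X).mPar A B = 𝟙 (A ⊕ₒ B) := rfl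
theorem id_nTop : (id X).nTop = 𝟙 (top X) := rfl
theorem id_nTen (A B : X) : (id X).nTen A B = 𝟙 (A ⊗ₒ B) := rfl
theorem id_nBot : (id X).nBot = 𝟙 (bot X) := rfl
theorem id_nPar (A B : X) : (id X).nPar A B = 𝟙 (A ⊕ₒ B) := rfl
theorem id_νtR (A B : X) : (id X).νtR A B = 𝟙 (A ⊕ₒ B) := rfl
theorem id_νtL (A B : X) : (id X).νtL A B = 𝟙 (A ⊕ₒ B) := rfl
theorem id_νpR (A B : X) : (id X).νpR A B = 𝟙 (A ⊗ₒ B) := rfl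
theorem id_νpL (A B : X) : (id X).νpL A B = 𝟙 (A ⊗ₒ B) := rfl

theorem isLinear_id : (id X).IsLinear := by
  -- With identity functors and identity structure maps, both sides of every axiom reduce to the
  -- same constraint map, or to the same map `f ⊕ₕ g` or `f ⊗ₕ g` for naturality.
  constructor <;> intros <;>
    simp only [id_Ft, id_Fp, id_mTop, id_mTen, id_nBot, id_nPar, id_νtR, id_νtL, id_νpR, id_νpL,
      Functor.id_obj, Functor.id_map, tHom_id, pHom_id, Category.id_comp, Category.comp_id]

end

variable [SymmetricMLDC X]

theorem isSymmetric_id : (id X).IsSymmetric := by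
  constructor <;> intros <;>
    simp only [id_Ft, id_Fp, id_mTen, id_nPar, id_νtR, id_νtL, id_νpR, id_νpL,
      Functor.id_obj, Functor.id_map, Category.id_comp, Category.comp_id]

theorem isMedial_id : (id X).IsMedial := by
  refine ⟨isLinear_id X, isSymmetric_id X, inferInstanceAs (IsIso (𝟙 (top X))),
    fun A B => inferInstanceAs (IsIso (𝟙 (A ⊗ₒ B))), inferInstanceAs (IsIso (𝟙 (bot X))),
    fun A B => inferInstanceAs (IsIso (𝟙 (A ⊕ₒ B))), ?_, ?_, ?_, ?_, ?_, ?_, ?_, ?_, ?_, ?_,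
    ?_, ?_, ?_, ?_, ?_, ?_⟩ <;> intros <;>
    simp only [id_Ft, id_Fp, id_mTop, id_mTen, id_mBot, id_mPar, id_nTop, id_nTen, id_nBot,
      id_nPar, id_νtR, id_νpR, IsIso.inv_id,
      Functor.id_obj, Functor.id_map, tHom_id, pHom_id, Category.id_comp, Category.comp_id]

end Id

end MedialFunctorData

/-! ### Naturality of structure maps and strengths, jointly and in one variable -/

section Naturality

variable {X : Type u} [Category.{v} X] {Y : Type u} [Category.{v} Y] [LDC X] [LDC Y]

namespace LinearFunctorData

variable (F : LinearFunctorData X Y)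

theorem mTen_natural {A A' B B' : X} (f : A ⟶ A') (g : B ⟶ B') :
    (F.Ft.map f ⊗ₕ F.Ft.map g) ≫ F.mTen A' B' = F.mTen A B ≫ F.Ft.map (f ⊗ₕ g) :=
  @Functor.LaxMonoidal.μ_natural _ _ TwoMonoidal.ten _ _ TwoMonoidal.ten F.Ft F.tLax _ _ _ _ f g

theorem nPar_natural {A A' B B' : X} (f : A ⟶ A') (g : B ⟶ B') :
    F.nPar A B ≫ (F.Fp.map f ⊕ₕ F.Fp.map g) = F.Fp.map (f ⊕ₕ g) ≫ F.nPar A' B' :=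
  @Functor.OplaxMonoidal.δ_natural _ _ TwoMonoidal.par _ _ TwoMonoidal.par F.Fp F.pOplax
    _ _ _ _ f g

/-- The axioms pair a structure map with the identity of `F.Ft.obj B`, not with the image of an
identity, so naturality is needed with that identity already simplified. The other one-variable
versions, including those for the strengths, serve the same purpose. -/
theorem mTen_natural_left {A A' : X} (f : A ⟶ A') (B : X) :
    (F.Ft.map f ⊗ₕ 𝟙 (F.Ft.obj B)) ≫ F.mTen A' B = F.mTen A B ≫ F.Ft.map (f ⊗ₕ 𝟙 B) := by
  rw [← F.mTen_natural, CategoryTheory.Functor.map_id]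

theorem mTen_natural_right (A : X) {B B' : X} (g : B ⟶ B') :
    (𝟙 (F.Ft.obj A) ⊗ₕ F.Ft.map g) ≫ F.mTen A B' = F.mTen A B ≫ F.Ft.map (𝟙 A ⊗ₕ g) := by
  rw [← F.mTen_natural, CategoryTheory.Functor.map_id]

theorem nPar_natural_left {A A' : X} (f : A ⟶ A') (B : X) :
    F.nPar A B ≫ (F.Fp.map f ⊕ₕ 𝟙 (F.Fp.obj B)) = F.Fp.map (f ⊕ₕ 𝟙 B) ≫ F.nPar A' B := by
  rw [← F.nPar_natural, CategoryTheory.Functor.map_id]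

theorem nPar_natural_right (A : X) {B B' : X} (g : B ⟶ B') :
    F.nPar A B ≫ (𝟙 (F.Fp.obj A) ⊕ₕ F.Fp.map g) = F.Fp.map (𝟙 A ⊕ₕ g) ≫ F.nPar A B' := by
  rw [← F.nPar_natural, CategoryTheory.Functor.map_id]

variable {F}

namespace IsLinear

theorem νtR_natural_left (hF : F.IsLinear) {A A' : X} (f : A ⟶ A') (B : X) :
    F.νtR A B ≫ (F.Fp.map f ⊕ₕ 𝟙 (F.Ft.obj B)) = F.Ft.map (f ⊕ₕ 𝟙 B) ≫ F.νtR A' B := by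
  rw [hF.νtR_natural, CategoryTheory.Functor.map_id]

theorem νtR_natural_right (hF : F.IsLinear) (A : X) {B B' : X} (g : B ⟶ B') :
    F.νtR A B ≫ (𝟙 (F.Fp.obj A) ⊕ₕ F.Ft.map g) = F.Ft.map (𝟙 A ⊕ₕ g) ≫ F.νtR A B' := by
  rw [hF.νtR_natural, CategoryTheory.Functor.map_id]

theorem νtL_natural_left (hF : F.IsLinear) {A A' : X} (f : A ⟶ A') (B : X) :
    F.νtL A B ≫ (F.Ft.map f ⊕ₕ 𝟙 (F.Fp.obj B)) = F.Ft.map (f ⊕ₕ 𝟙 B) ≫ F.νtL A' B := by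
  rw [hF.νtL_natural, CategoryTheory.Functor.map_id]

theorem νtL_natural_right (hF : F.IsLinear) (A : X) {B B' : X} (g : B ⟶ B') :
    F.νtL A B ≫ (𝟙 (F.Ft.obj A) ⊕ₕ F.Fp.map g) = F.Ft.map (𝟙 A ⊕ₕ g) ≫ F.νtL A B' := by
  rw [hF.νtL_natural, CategoryTheory.Functor.map_id]

theorem νpR_natural_left (hF : F.IsLinear) {A A' : X} (f : A ⟶ A') (B : X) :
    (F.Ft.map f ⊗ₕ 𝟙 (F.Fp.obj B)) ≫ F.νpR A' B = F.νpR A B ≫ F.Fp.map (f ⊗ₕ 𝟙 B) := by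
  rw [← hF.νpR_natural, CategoryTheory.Functor.map_id]

theorem νpR_natural_right (hF : F.IsLinear) (A : X) {B B' : X} (g : B ⟶ B') :
    (𝟙 (F.Ft.obj A) ⊗ₕ F.Fp.map g) ≫ F.νpR A B' = F.νpR A B ≫ F.Fp.map (𝟙 A ⊗ₕ g) := by
  rw [← hF.νpR_natural, CategoryTheory.Functor.map_id]

theorem νpL_natural_left (hF : F.IsLinear) {A A' : X} (f : A ⟶ A') (B : X) :
    (F.Fp.map f ⊗ₕ 𝟙 (F.Ft.obj B)) ≫ F.νpL A' B = F.νpL A B ≫ F.Fp.map (f ⊗ₕ 𝟙 B) := by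
  rw [← hF.νpL_natural, CategoryTheory.Functor.map_id]

theorem νpL_natural_right (hF : F.IsLinear) (A : X) {B B' : X} (g : B ⟶ B') :
    (𝟙 (F.Fp.obj A) ⊗ₕ F.Ft.map g) ≫ F.νpL A B' = F.νpL A B ≫ F.Fp.map (𝟙 A ⊗ₕ g) := by
  rw [← hF.νpL_natural, CategoryTheory.Functor.map_id]

end IsLinear

end LinearFunctorData

namespace MedialFunctorData

variable (F : MedialFunctorData X Y)

theorem mPar_natural {A A' B B' : X} (f : A ⟶ A') (g : B ⟶ B') :
    (F.Ft.map f ⊕ₕ F.Ft.map g) ≫ F.mPar A' B' = F.mPar A B ≫ F.Ft.map (f ⊕ₕ g) :=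
  @Functor.LaxMonoidal.μ_natural _ _ TwoMonoidal.par _ _ TwoMonoidal.par F.Ft F.pLax _ _ _ _ f g

theorem nTen_natural {A A' B B' : X} (f : A ⟶ A') (g : B ⟶ B') :
    F.nTen A B ≫ (F.Fp.map f ⊗ₕ F.Fp.map g) = F.Fp.map (f ⊗ₕ g) ≫ F.nTen A' B' :=
  @Functor.OplaxMonoidal.δ_natural _ _ TwoMonoidal.ten _ _ TwoMonoidal.ten F.Fp F.tOplax
    _ _ _ _ f g

theorem mPar_natural_left {A A' : X} (f : A ⟶ A') (B : X) :
    (F.Ft.map f ⊕ₕ 𝟙 (F.Ft.obj B)) ≫ F.mPar A' B = F.mPar A B ≫ F.Ft.map (f ⊕ₕ 𝟙 B) := by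
  rw [← F.mPar_natural, CategoryTheory.Functor.map_id]

theorem nTen_natural_left {A A' : X} (f : A ⟶ A') (B : X) :
    F.nTen A B ≫ (F.Fp.map f ⊗ₕ 𝟙 (F.Fp.obj B)) = F.Fp.map (f ⊗ₕ 𝟙 B) ≫ F.nTen A' B := by
  rw [← F.nTen_natural, CategoryTheory.Functor.map_id]

end MedialFunctorData

end Naturality

/-! ### Composition of 1-cells -/

namespace MedialFunctorData

variable {X : Type u} [Category.{v} X] {Y : Type u} [Category.{v} Y] {Z : Type u} [Category.{v} Z]

section Comp

variable [LDC X] [LDC Y] [LDC Z] (F : MedialFunctorData X Y) (G : MedialFunctorData Y Z)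

theorem comp_Ft : (F.comp G).Ft = F.Ft ⋙ G.Ft := rfl
theorem comp_Fp : (F.comp G).Fp = F.Fp ⋙ G.Fp := rfl
theorem comp_mTop : (F.comp G).mTop = G.mTop ≫ G.Ft.map F.mTop := rfl
theorem comp_mTen (A B : X) : (F.comp G).mTen A B = G.mTen _ _ ≫ G.Ft.map (F.mTen A B) := rfl
theorem comp_mBot : (F.comp G).mBot = G.mBot ≫ G.Ft.map F.mBot := rfl
theorem comp_mPar (A B : X) : (F.comp G).mPar A B = G.mPar _ _ ≫ G.Ft.map (F.mPar A B) := rfl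
theorem comp_nTop : (F.comp G).nTop = G.Fp.map F.nTop ≫ G.nTop := rfl
theorem comp_nTen (A B : X) : (F.comp G).nTen A B = G.Fp.map (F.nTen A B) ≫ G.nTen _ _ := rfl
theorem comp_nBot : (F.comp G).nBot = G.Fp.map F.nBot ≫ G.nBot := rfl
theorem comp_nPar (A B : X) : (F.comp G).nPar A B = G.Fp.map (F.nPar A B) ≫ G.nPar _ _ := rfl
theorem comp_νtR (A B : X) : (F.comp G).νtR A B = G.Ft.map (F.νtR A B) ≫ G.νtR _ _ := rfl
theorem comp_νtL (A B : X) : (F.comp G).νtL A B = G.Ft.map (F.νtL A B) ≫ G.νtL _ _ := rfl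
theorem comp_νpR (A B : X) : (F.comp G).νpR A B = G.νpR _ _ ≫ G.Fp.map (F.νpR A B) := rfl
theorem comp_νpL (A B : X) : (F.comp G).νpL A B = G.νpL _ _ ≫ G.Fp.map (F.νpL A B) := rfl

variable {F G}

/-- Each axiom for the composite is the axiom for `G` pasted to the `G`-image of the axiom for `F`,
along naturality squares of the structure maps of `G`. -/
theorem isLinear_comp (hF : F.IsLinear) (hG : G.IsLinear) : (F.comp G).IsLinear := by
  constructor <;> intros <;>
    simp only [comp_Ft, comp_Fp, comp_mTop, comp_mTen, comp_nBot, comp_nPar, comp_νtR, comp_νtL,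
      comp_νpR, comp_νpL, Functor.comp_obj, Functor.comp_map, comp_tHom_id, id_tHom_comp,
      comp_pHom_id, id_pHom_comp, Category.assoc]
  · rw [← hG.νtR_natural, ← Functor.map_comp_assoc, hF.νtR_natural, Functor.map_comp_assoc]
  · rw [← hG.νtL_natural, ← Functor.map_comp_assoc, hF.νtL_natural, Functor.map_comp_assoc]
  · rw [reassoc_of% (@hG.νpR_natural), ← Functor.map_comp, hF.νpR_natural, Functor.map_comp]
  · rw [reassoc_of% (@hG.νpL_natural), ← Functor.map_comp, hF.νpL_natural, Functor.map_comp]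
  -- Naturality carries the `G`-image of `F.nBot` to the other side of the strength of `G`. The unit
  -- law of `G` then closes its own part, and what is left is the image of the unit law of `F`.
  · rw [reassoc_of% hG.νtR_natural_left, hG.νtR_unit, ← Functor.map_comp, ← Functor.map_comp,
      hF.νtR_unit]
  · rw [reassoc_of% hG.νtL_natural_right, hG.νtL_unit, ← Functor.map_comp, ← Functor.map_comp,
      hF.νtL_unit]
  · rw [reassoc_of% (@hG.νpR_natural_left), reassoc_of% hG.νpR_unit, ← Functor.map_comp,
      ← Functor.map_comp, hF.νpR_unit]
  · rw [reassoc_of% (@hG.νpL_natural_right), reassoc_of% hG.νpL_unit, ← Functor.map_comp,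
      ← Functor.map_comp, hF.νpL_unit]
  -- Here and in the cases below, `h` is the `G`-image of the axiom for `F`, with the functor
  -- distributed over composites so that it can be applied inside a longer string.
  · have h A B C := congrArg G.Ft.map (hF.νtR_assoc A B C)
    simp only [Functor.map_comp] at h
    simp only [reassoc_of% (@hG.νtR_natural_right), hG.νtR_assoc,
      reassoc_of% (@hG.νtR_natural_left), reassoc_of% h]
  · have h A B C := congrArg G.Ft.map (hF.νtL_assoc A B C)
    simp only [Functor.map_comp] at h
    simp only [reassoc_of% (@hG.νtL_natural_right), hG.νtL_assoc,
      reassoc_of% (@hG.νtL_natural_left), reassoc_of% h]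
  · have h A B C := congrArg G.Fp.map (hF.νpR_assoc A B C)
    simp only [Functor.map_comp] at h
    simp only [reassoc_of% (@hG.νpR_natural_right), reassoc_of% (@hG.νpR_assoc),
      reassoc_of% (@hG.νpR_natural_left), h]
  · have h A B C := congrArg G.Fp.map (hF.νpL_assoc A B C)
    simp only [Functor.map_comp] at h
    simp only [reassoc_of% (@hG.νpL_natural_right), reassoc_of% (@hG.νpL_assoc),
      reassoc_of% (@hG.νpL_natural_left), h]
  -- The axiom of `G` is read from right to left: it trades the distributivity of the last category
  -- for the `G`-image of that of the middle one. All `G`-images can then be gathered between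
  -- `G.mTen` and the strength of `G`.
  · have h A B C := congrArg G.Ft.map (hF.νtR_δR A B C)
    simp only [Functor.map_comp] at h
    simp only [← reassoc_of% (@hG.νtR_δR), hG.νtR_natural_right,
      reassoc_of% (@G.mTen_natural_left), reassoc_of% h]
  · have h A B C := congrArg G.Ft.map (hF.νtL_δL A B C)
    simp only [Functor.map_comp] at h
    simp only [← reassoc_of% (@hG.νtL_δL), hG.νtL_natural_left,
      reassoc_of% (@G.mTen_natural_right), reassoc_of% h]
  · have h A B C := congrArg G.Fp.map (hF.νpR_δL A B C)
    simp only [Functor.map_comp] at h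
    simp only [← reassoc_of% (@hG.νpR_δL), reassoc_of% (@hG.νpR_natural_right),
      G.nPar_natural_left, reassoc_of% h]
  · have h A B C := congrArg G.Fp.map (hF.νpL_δR A B C)
    simp only [Functor.map_comp] at h
    simp only [← reassoc_of% (@hG.νpL_δR), reassoc_of% (@hG.νpL_natural_left),
      G.nPar_natural_right, reassoc_of% h]
  · have h A B C := congrArg G.Ft.map (hF.νtR_νtL A B C)
    simp only [Functor.map_comp] at h
    simp only [reassoc_of% (@hG.νtR_natural_right), hG.νtR_νtL,
      reassoc_of% (@hG.νtL_natural_left), reassoc_of% h]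
  · have h A B C := congrArg G.Fp.map (hF.νpL_νpR A B C)
    simp only [Functor.map_comp] at h
    simp only [reassoc_of% (@hG.νpR_natural_right), reassoc_of% (@hG.νpL_νpR),
      reassoc_of% (@hG.νpL_natural_left), h]
  · have h A B C := congrArg G.Ft.map (hF.νtR_δL A B C)
    simp only [Functor.map_comp] at h
    simp only [← reassoc_of% (@hG.νtR_δL), hG.νtR_natural_left,
      reassoc_of% (@G.mTen_natural_right), reassoc_of% h]
  · have h A B C := congrArg G.Ft.map (hF.νtL_δR A B C)
    simp only [Functor.map_comp] at h
    simp only [← reassoc_of% (@hG.νtL_δR), hG.νtL_natural_right,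
      reassoc_of% (@G.mTen_natural_left), reassoc_of% h]
  · have h A B C := congrArg G.Fp.map (hF.νpR_δR A B C)
    simp only [Functor.map_comp] at h
    simp only [← reassoc_of% (@hG.νpR_δR), reassoc_of% (@hG.νpR_natural_left),
      G.nPar_natural_right, reassoc_of% h]
  · have h A B C := congrArg G.Fp.map (hF.νpL_δL A B C)
    simp only [Functor.map_comp] at h
    simp only [← reassoc_of% (@hG.νpL_δL), reassoc_of% (@hG.νpL_natural_right),
      G.nPar_natural_left, reassoc_of% h]

end Comp

/-- The naturality square of `m_⊗` with its two invertible sides reversed. The compatibility of the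
strength with the medial map contains `m_⊗⁻¹`, and this lets images of maps under the functor cross
it. -/
theorem inv_mTen_natural [LDC X] [LDC Y] (F : MedialFunctorData X Y) {A A' B B' : X} (f : A ⟶ A')
    (g : B ⟶ B') [IsIso (F.mTen A B)] [IsIso (F.mTen A' B')] :
    inv (F.mTen A B) ≫ (F.Ft.map f ⊗ₕ F.Ft.map g) = F.Ft.map (f ⊗ₕ g) ≫ inv (F.mTen A' B') := by
  rw [IsIso.inv_comp_eq, ← reassoc_of% (F.mTen_natural f g), IsIso.hom_inv_id, Category.comp_id]

theorem inv_nPar_natural [LDC X] [LDC Y] (F : MedialFunctorData X Y) {A A' B B' : X} (f : A ⟶ A')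
    (g : B ⟶ B') [IsIso (F.nPar A B)] [IsIso (F.nPar A' B')] :
    (F.Fp.map f ⊕ₕ F.Fp.map g) ≫ inv (F.nPar A' B') = inv (F.nPar A B) ≫ F.Fp.map (f ⊕ₕ g) := by
  rw [IsIso.eq_inv_comp, reassoc_of% (F.nPar_natural f g), IsIso.hom_inv_id, Category.comp_id]

variable [SymmetricMLDC X] [SymmetricMLDC Y] [SymmetricMLDC Z]
  {F : MedialFunctorData X Y} {G : MedialFunctorData Y Z}

theorem isSymmetric_comp (hF : F.IsSymmetric) (hG : G.IsSymmetric) : (F.comp G).IsSymmetric := by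
  constructor <;> intros <;>
    simp only [comp_Ft, comp_Fp, comp_mTen, comp_nPar, comp_νtR, comp_νtL, comp_νpR, comp_νpL,
      Functor.comp_obj, Functor.comp_map, Category.assoc]
  · rw [← Functor.map_comp, hF.mTen_braid, Functor.map_comp, reassoc_of% hG.mTen_braid]
  · rw [← Functor.map_comp_assoc, hF.nPar_braid, Functor.map_comp_assoc, hG.nPar_braid]
  · rw [hG.νt_braid, ← Functor.map_comp_assoc, hF.νt_braid, Functor.map_comp_assoc]
  · rw [← Functor.map_comp, hF.νp_braid, Functor.map_comp, reassoc_of% hG.νp_braid]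

/-- The same pasting as for linear functors, now with the additional (co)monoidal structures.
Inverses of composites reverse their factors, and `G` preserves inverses, so the inverted structure
maps of the composite also split into a part from `G` and the image of a part from `F`. -/
theorem isMedial_comp (hF : F.IsMedial) (hG : G.IsMedial) : (F.comp G).IsMedial := by
  have := hF.mTop_iso
  have := hF.mTen_iso
  have := hF.nBot_iso
  have := hF.nPar_iso
  have := hG.mTop_iso
  have := hG.mTen_iso
  have := hG.nBot_iso
  have := hG.nPar_iso
  -- Strength of the composite: functors preserve isomorphisms, and isomorphisms compose.
  refine ⟨isLinear_comp hF.isLinear hG.isLinear, isSymmetric_comp hF.isSymmetric hG.isSymmetric,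
    inferInstanceAs (IsIso (G.mTop ≫ G.Ft.map F.mTop)),
    fun A B => inferInstanceAs (IsIso (G.mTen _ _ ≫ G.Ft.map (F.mTen A B))),
    inferInstanceAs (IsIso (G.Fp.map F.nBot ≫ G.nBot)),
    fun A B => inferInstanceAs (IsIso (G.Fp.map (F.nPar A B) ≫ G.nPar _ _)),
    ?_, ?_, ?_, ?_, ?_, ?_, ?_, ?_, ?_, ?_, ?_, ?_, ?_, ?_, ?_, ?_⟩ <;> intros <;>
    simp only [comp_Ft, comp_Fp, comp_mTop, comp_mTen, comp_mBot, comp_mPar, comp_nTop, comp_nTen,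
      comp_nBot, comp_nPar, comp_νtR, comp_νpR, IsIso.inv_comp, ← Functor.map_inv,
      Functor.comp_obj, Functor.comp_map, comp_tHom_id, id_tHom_comp, comp_pHom_id, id_pHom_comp,
      ← tHom_comp, ← pHom_comp, Category.assoc]
  · rw [← Functor.map_comp, hF.mPar_braid, Functor.map_comp, reassoc_of% hG.mPar_braid]
  · rw [← Functor.map_comp_assoc, hF.nTen_braid, Functor.map_comp_assoc, hG.nTen_braid]
  · have h := congrArg G.Ft.map hF.mBot_Δbot
    simp only [Functor.map_comp] at h
    simp only [reassoc_of% (@G.mTen_natural), reassoc_of% hG.mBot_Δbot, h]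
  · have h := congrArg G.Ft.map hF.mTop_nablaTop
    simp only [Functor.map_comp] at h
    simp only [reassoc_of% (@G.mPar_natural), h, reassoc_of% hG.mTop_nablaTop]
  · have h := congrArg G.Ft.map hF.mix_mTop
    simp only [Functor.map_comp] at h
    simp only [← h, reassoc_of% hG.mix_mTop]
  · have h A B C D := congrArg G.Ft.map (hF.mTen_μ A B C D)
    simp only [Functor.map_comp] at h
    simp only [reassoc_of% (@G.mPar_natural), reassoc_of% (@G.mTen_natural), h,
      reassoc_of% hG.mTen_μ]
  · have h := congrArg G.Fp.map hF.nBot_Δbot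
    simp only [Functor.map_comp] at h
    simp only [reassoc_of% (@G.nTen_natural), reassoc_of% h, hG.nBot_Δbot]
  · have h := congrArg G.Fp.map hF.nTop_nablaTop
    simp only [Functor.map_comp] at h
    simp only [reassoc_of% (@G.nPar_natural), hG.nTop_nablaTop, reassoc_of% h]
  · have h := congrArg G.Fp.map hF.nBot_mix
    simp only [Functor.map_comp] at h
    simp only [hG.nBot_mix, reassoc_of% h]
  · have h A B C D := congrArg G.Fp.map (hF.nPar_μ A B C D)
    simp only [Functor.map_comp] at h
    simp only [reassoc_of% (@G.nTen_natural), reassoc_of% (@G.nPar_natural), reassoc_of% h,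
      hG.nPar_μ]
  -- Once `F.mBot ⊗ F.nBot⁻¹`, under `G`, has been moved past `G.νpR`, the segment from `G.nBot` to
  -- `G.νpR` is exactly the right side of the clause for `G`. It folds back to the `G`-image of the
  -- contraction of the middle category. The next case is its dual.
  · have h := congrArg G.Fp.map hF.νpR_Δbot
    simp only [Functor.map_comp] at h
    simp only [reassoc_of% (@hG.isLinear.νpR_natural), ← reassoc_of% hG.νpR_Δbot, h]
  · have h := congrArg G.Ft.map hF.νtR_nablaTop
    simp only [Functor.map_comp] at h
    simp only [← reassoc_of% (@hG.isLinear.νtR_natural), ← reassoc_of% hG.νtR_nablaTop, h]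
  -- The images of the two strengths of `F` must cross `G.mTen⁻¹` to meet the image of `F.mTen⁻¹`;
  -- after that the clauses for `F` and then `G` apply.
  · have h A B C D := congrArg G.Ft.map (hF.νtR_μ A B C D)
    simp only [Functor.map_comp] at h
    simp only [reassoc_of% (@G.inv_mTen_natural), ← reassoc_of% (@hG.isLinear.νtR_natural),
      reassoc_of% h, hG.νtR_μ]
  · have h A B C D := congrArg G.Fp.map (hF.νpR_μ A B C D)
    simp only [Functor.map_comp] at h
    simp only [reassoc_of% (@G.inv_nPar_natural), reassoc_of% (@hG.isLinear.νpR_natural), h,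
      reassoc_of% hG.νpR_μ]
  · have h A B C := congrArg G.Ft.map (hF.νtR_mPar A B C)
    simp only [Functor.map_comp] at h
    simp only [← reassoc_of% hG.νtR_mPar, hG.isLinear.νtR_natural_right,
      reassoc_of% (@G.mPar_natural_left), reassoc_of% h]
  · have h A B C := congrArg G.Fp.map (hF.νpR_nTen A B C)
    simp only [Functor.map_comp] at h
    simp only [← reassoc_of% hG.νpR_nTen, reassoc_of% (@hG.isLinear.νpR_natural_right),
      G.nTen_natural_left, reassoc_of% h]

end MedialFunctorData

/-! ### Identities, vertical composites and horizontal composites of 2-cells -/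

namespace TransData

open MedialFunctorData (comp_Ft comp_Fp comp_mTop comp_mTen comp_mBot comp_mPar comp_nTop comp_nTen
  comp_nBot comp_nPar comp_νtR comp_νtL comp_νpR comp_νpL)

variable {X : Type u} [Category.{v} X] {Y : Type u} [Category.{v} Y] {Z : Type u} [Category.{v} Z]
  [LDC X] [LDC Y] [LDC Z]

theorem isMedial_id (F : MedialFunctorData X Y) : (id F).IsMedial := by
  constructor <;> intros <;>
    simp only [id, NatTrans.id_app, tHom_id, pHom_id, Category.id_comp, Category.comp_id]

theorem isMedial_comp {F G H : MedialFunctorData X Y} {α : TransData F G} {β : TransData G H}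
    (hα : α.IsMedial) (hβ : β.IsMedial) : (α.comp β).IsMedial := by
  constructor <;> intros <;>
    simp only [comp, NatTrans.comp_app, comp_tHom_id, id_tHom_comp, comp_pHom_id, id_pHom_comp,
      ← tHom_comp, ← pHom_comp, Category.assoc]
  · rw [reassoc_of% hα.t_mTop, hβ.t_mTop]
  · rw [reassoc_of% hα.t_mTen, hβ.t_mTen]
  · rw [reassoc_of% hα.t_mBot, hβ.t_mBot]
  · rw [reassoc_of% hα.t_mPar, hβ.t_mPar]
  · rw [hα.p_nBot, hβ.p_nBot]
  · rw [hα.p_nPar, reassoc_of% hβ.p_nPar]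
  · rw [hα.p_nTop, hβ.p_nTop]
  · rw [hα.p_nTen, reassoc_of% hβ.p_nTen]
  -- The square for `β` leaves `β_⊗` in one slot before `α_⊕` in the other. Exchanging them exposes
  -- the square for `α`. In the two cases for `ν_⊕` it is `α_⊗` and `β_⊕` that are exchanged.
  · rw [reassoc_of% hβ.νtR, pHom_exchange, reassoc_of% hα.νtR]
  · rw [reassoc_of% hβ.νtL, ← pHom_exchange, reassoc_of% hα.νtL]
  · rw [reassoc_of% hβ.νpL, reassoc_of% (@tHom_exchange), hα.νpL]
  · rw [reassoc_of% hβ.νpR, ← reassoc_of% (@tHom_exchange), hα.νpR]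

/-- Naturality of `β` at the structure maps of `F` brings its components next to the structure maps
of `G` and `G'`, where the axioms of `β` apply at objects in the image of `F`. No axiom of `F`
enters. -/
theorem isMedial_whiskerLeft (F : MedialFunctorData X Y) {G G' : MedialFunctorData Y Z}
    {β : TransData G G'} (hβ : β.IsMedial) : (whiskerLeft F β).IsMedial := by
  constructor <;> intros <;>
    simp only [whiskerLeft, comp_Ft, comp_Fp, comp_mTop, comp_mTen, comp_mBot, comp_mPar, comp_nTop,
      comp_nTen, comp_nBot, comp_nPar, comp_νtR, comp_νtL, comp_νpR, comp_νpL,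
      Functor.whiskerLeft_app, Functor.comp_obj, NatTrans.naturality,
      ← NatTrans.naturality_assoc, Category.assoc]
  · rw [reassoc_of% hβ.t_mTop]
  · rw [reassoc_of% hβ.t_mTen]
  · rw [reassoc_of% hβ.t_mBot]
  · rw [reassoc_of% hβ.t_mPar]
  · rw [hβ.p_nBot]
  · rw [hβ.p_nPar]
  · rw [hβ.p_nTop]
  · rw [hβ.p_nTen]
  · rw [hβ.νtR]
  · rw [hβ.νtL]
  · rw [reassoc_of% hβ.νpL]
  · rw [reassoc_of% hβ.νpR]

/-- Each axiom is the `G`-image of the one for `α`, after the components of `α` are moved through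
the structure maps of `G`. For the (co)monoidal maps this naturality is part of their structure; for
the strengths it is what linearity of `G` provides. -/
theorem isMedial_whiskerRight {F F' : MedialFunctorData X Y} {α : TransData F F'}
    (hα : α.IsMedial) {G : MedialFunctorData Y Z} (hG : G.IsLinear) :
    (whiskerRight α G).IsMedial := by
  constructor <;> intros <;>
    simp only [whiskerRight, comp_Ft, comp_Fp, comp_mTop, comp_mTen, comp_mBot, comp_mPar, comp_nTop,
      comp_nTen, comp_nBot, comp_nPar, comp_νtR, comp_νtL, comp_νpR, comp_νpL,
      Functor.whiskerRight_app, Functor.comp_obj, Category.assoc]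
  · rw [← Functor.map_comp, hα.t_mTop]
  · rw [← Functor.map_comp, hα.t_mTen, Functor.map_comp, reassoc_of% (@G.mTen_natural)]
  · rw [← Functor.map_comp, hα.t_mBot]
  · rw [← Functor.map_comp, hα.t_mPar, Functor.map_comp, reassoc_of% (@G.mPar_natural)]
  · rw [← Functor.map_comp_assoc, hα.p_nBot]
  · rw [← Functor.map_comp_assoc, hα.p_nPar, Functor.map_comp_assoc, G.nPar_natural]
  · rw [← Functor.map_comp_assoc, hα.p_nTop]
  · rw [← Functor.map_comp_assoc, hα.p_nTen, Functor.map_comp_assoc, G.nTen_natural]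
  · rw [hG.νtR_natural_left, hG.νtR_natural_right]
    simp only [← Functor.map_comp_assoc, hα.νtR]
  · rw [hG.νtL_natural_right, hG.νtL_natural_left]
    simp only [← Functor.map_comp_assoc, hα.νtL]
  · rw [reassoc_of% (@hG.νpL_natural_right), reassoc_of% (@hG.νpL_natural_left)]
    simp only [← Functor.map_comp, hα.νpL]
  · rw [reassoc_of% (@hG.νpR_natural_left), reassoc_of% (@hG.νpR_natural_right)]
    simp only [← Functor.map_comp, hα.νpR]

/-- In the `⊗` component both sides use the same order of composition. In the `⊕` component 2-cells
point backwards, so the whiskerings compose in the opposite order, and the two sides are the two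
legs of a naturality square of `β_⊕`. -/
theorem whiskerLeft_comp_whiskerRight {F F' : MedialFunctorData X Y} {G G' : MedialFunctorData Y Z}
    (α : TransData F F') (β : TransData G G') :
    (whiskerLeft F β).comp (whiskerRight α G') = hcomp α β :=
  TransData.ext rfl (NatTrans.ext (funext fun A => β.p.naturality (α.p.app A)))

theorem isMedial_hcomp {F F' : MedialFunctorData X Y} {α : TransData F F'} (hα : α.IsMedial)
    {G G' : MedialFunctorData Y Z} {β : TransData G G'} (hβ : β.IsMedial) (hG' : G'.IsLinear) :
    (hcomp α β).IsMedial :=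
  whiskerLeft_comp_whiskerRight α β ▸
    isMedial_comp (isMedial_whiskerLeft F hβ) (isMedial_whiskerRight hα hG')

end TransData

/-! ### Closure, strictness and the 2-category -/

namespace SMLDC

theorem isClosed : IsClosed.{v, u} where
  id_functor X := MedialFunctorData.isMedial_id X.carrier
  comp_functor F G := MedialFunctorData.isMedial_comp F.isMedial G.isMedial
  id_trans F := TransData.isMedial_id F.data
  comp_trans α β := TransData.isMedial_comp α.isMedial β.isMedial
  hcomp_trans {_ _ _ _ _ _ G'} α β :=
    TransData.isMedial_hcomp α.isMedial β.isMedial G'.isMedial.isLinear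
  whiskerLeft_trans F _ _ β := TransData.isMedial_whiskerLeft F.data β.isMedial
  whiskerRight_trans α G := TransData.isMedial_whiskerRight α.isMedial G.isMedial.isLinear

/-- A 2-cell whose components are identities along an equality of 1-cells is the canonical one. -/
theorem eq_eqToHom (h : IsClosed.{v, u}) {X Y : SMLDC.{v, u}} {F F' : MedialLinearFunctor X Y}
    (e : F = F') (α : MedialLinearTransformation F F') (ht : α.data.t = eqToHom (by rw [e]))
    (hp : α.data.p = eqToHom (by rw [e])) :
    α = @eqToHom _ (homCategory h X Y).toCategoryStruct _ _ e := by
  subst e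
  exact MedialLinearTransformation.ext (TransData.ext ht hp)

/-- The unit and associativity equations of 1-cells reduce to those of their data, since the axioms
are propositions. The underlying functors on the two sides agree definitionally, so the canonical
2-cells along these equations have identity components, as the unitors and associators do. -/
theorem strict_bicategory (h : IsClosed.{v, u}) :
    @Bicategory.Strict SMLDC.{v, u} (bicategory h) :=
  letI := bicategory h
  { id_comp := fun F => MedialLinearFunctor.ext F.data.id_comp
    comp_id := fun F => MedialLinearFunctor.ext F.data.comp_id
    assoc := fun F G H => MedialLinearFunctor.ext (F.data.assoc G.data H.data)
    leftUnitor_eqToIso := fun F =>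
      Iso.ext (eq_eqToHom h (MedialLinearFunctor.ext F.data.id_comp) _ rfl rfl)
    rightUnitor_eqToIso := fun F =>
      Iso.ext (eq_eqToHom h (MedialLinearFunctor.ext F.data.comp_id) _ rfl rfl)
    associator_eqToIso := fun F G H =>
      Iso.ext (eq_eqToHom h (MedialLinearFunctor.ext (F.data.assoc G.data H.data)) _ rfl rfl) }

end SMLDC

end MedialLD

theorem mainTheorem4 :
    ∃ h : MedialLD.SMLDC.IsClosed.{v, u},
      letI : Bicategory.{max u v, max u v} MedialLD.SMLDC.{v, u} := MedialLD.SMLDC.bicategory h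
      Bicategory.Strict MedialLD.SMLDC.{v, u} ∧
        ∀ {X Y Z : MedialLD.SMLDC.{v, u}} {F F' : X ⟶ Y} {G G' : Y ⟶ Z} (α : F ⟶ F') (β : G ⟶ G'),
          Bicategory.whiskerLeft F β ≫ Bicategory.whiskerRight α G' =
            ⟨MedialLD.TransData.hcomp α.data β.data, h.hcomp_trans α β⟩ :=
  ⟨MedialLD.SMLDC.isClosed, MedialLD.SMLDC.strict_bicategory _, fun α β =>
    -- A 2-cell is determined by its pair of natural transformations, so the factorisation through
    -- whiskerings at the level of data suffices.
    MedialLD.MedialLinearTransformation.ext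
      (MedialLD.TransData.whiskerLeft_comp_whiskerRight α.data β.data)⟩
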